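/- **Setting.** Fix $S>1$. Data are $n$ points $X_1,\dots,X_n\in\mathbb R^2$. Put $J=\lceil\log_2 n\rceil$ and, for $0\le j\le J$, $w=2^{-j}$, $t=2^{-(J-j)+1}$, $\delta_1=t/4$, $\delta_2=t/(4w)$. For integers $0\le k<w^{-1}$, $0\le \ell_1\le\delta_1^{-1}-1$, $|\ell_2|\le S\delta_2^{-1}$ let $R(j,k,\ell_1,\ell_2)$ be the parallelogram with vertical sides, of width $w$ and vertical thickness $t$, lying over $[kw,(k+1)w)$, whose midline passes through $((k+\tfrac12)w,\ell_1\delta_1)$ with slope $\ell_2\delta_2$. These strips are the vertices of a directed graph $\mathcal G(j)$ with edges $(k,\ell_1,\ell_2)\mapsto(k+1,\ell_1+\ell_2+u,\ell_2+v)$, $|u|,|v|\le4$ (both ends being vertices). **Test.** Given a count threshold $N^*$ and run-length thresholds $L_n^*$, call $R$ significant if $\#\{i:X_i\in R\}>N^*$, and let $L_n^{\max}$ be the largest number $m$ of strips in a path $(R_1,\dots,R_m)$ of significant strips in some $\mathcal G(j)$, $0\le j\le J$. The test rejects $\mathbf H_0$ if $L_n^{\max}>L_n^*$. **Hypotheses.**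 $\mathbf H_0$: the $X_i$ are i.i.d. uniform on $[0,1]^2$. For $1<\alpha\le2$ and $\beta>0$, $\mathrm{Hölder}(\alpha,\beta;S)$ is the class of continuously differentiable $f:[0,1]\to[0,1]$ with $|f'(x)-f'(y)|\le\alpha\beta|x-y|^{\alpha-1}$ and $|f'|\le S$. $\mathbf H_1(\alpha,\beta,S,\tau)$: the $X_i$ are i.i.d. from $(1-\varepsilon_n)\,\mathrm{Uniform}([0,1]^2)+\varepsilon_n\,\mathrm{Uniform}(\mathrm{graph} f)$ for some $f\in\mathrm{Hölder}(\alpha,\beta;S)$ and some $\tau n^{-\alpha/(1+\alpha)}<\varepsilon_n\le1$, where $\mathrm{Uniform}(\mathrm{graph} f)$ is normalized arc length. **Theorem 3.1.** Let $p_0\in(0,1)$. There are integers $N^*\ge 0$ with $P\{\mathrm{Poisson}(2)>N^*\}\le p_0/162$; take any such $N^*$, and let $L_n^*=3\log n/\log(1/p_0)$. With these thresholds, which do not depend on $\alpha$ or $\beta$: 1. For all $\alpha\in(1,2]$ and $\beta>0$ there is a constant $T_*=T_*(\alpha,\beta,S)>0$ (it may also depend on the fixed $p_0$, $N^*$) such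 that for every $\tau>T_*$ the probability that the test rejects $\mathbf H_0$ under $\mathbf H_1(\alpha,\beta,S,\tau)$ tends to $1$ as $n\to\infty$, uniformly over all $f$ and $\varepsilon_n$ allowed by $\mathbf H_1(\alpha,\beta,S,\tau)$. 2. The probability that the test rejects $\mathbf H_0$ under $\mathbf H_0$ tends to $0$ as $n\to\infty$. -/

import Mathlib

open Set Filter Topology MeasureTheory ProbabilityTheory

namespace SigRuns

noncomputable section

/-! ### The two hypotheses -/

/-- `f` belongs to the class Hölder(α, β; S): it maps `[0,1]` to `[0,1]`, is continuously
differentiable on `[0,1]` (one-sided derivatives at the end points), its derivative satisfies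
`|f'(x) - f'(y)| ≤ α β |x - y|^(α - 1)`, and `|f'| ≤ S`. -/
structure HolderClass (α β S : ℝ) (f : ℝ → ℝ) : Prop where
  mapsTo : MapsTo f (Icc 0 1) (Icc 0 1)
  differentiableOn : DifferentiableOn ℝ f (Icc 0 1)
  continuousOn_deriv : ContinuousOn (derivWithin f (Icc 0 1)) (Icc 0 1)
  holder : ∀ x ∈ Icc (0 : ℝ) 1, ∀ y ∈ Icc (0 : ℝ) 1,
    |derivWithin f (Icc 0 1) x - derivWithin f (Icc 0 1) y| ≤ α * β * |x - y| ^ (α - 1)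
  slope : ∀ x ∈ Icc (0 : ℝ) 1, |derivWithin f (Icc 0 1) x| ≤ S

/-- The uniform distribution on the unit square. -/
def unifSquare : Measure (ℝ × ℝ) := volume.restrict (Icc 0 1 ×ˢ Icc 0 1)

/-- Arc length on the graph of `f` over `[0,1]`, as a measure on the plane: the image of
`√(1 + f'(x)²) dx` under `x ↦ (x, f x)`. -/
def arcLength (f : ℝ → ℝ) : Measure (ℝ × ℝ) :=
  ((volume.restrict (Icc (0 : ℝ) 1)).withDensity
    (fun x => ENNReal.ofReal (Real.sqrt (1 + derivWithin f (Icc 0 1) x ^ 2)))).map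
    (fun x => (x, f x))

/-- The uniform distribution on the graph of `f`: normalized arc length. -/
def unifGraph (f : ℝ → ℝ) : Measure (ℝ × ℝ) := (arcLength f univ)⁻¹ • arcLength f

/-- The contaminated distribution `(1 - ε) Uniform(0,1)² + ε Uniform(graph f)`. -/
def mixture (ε : ℝ) (f : ℝ → ℝ) : Measure (ℝ × ℝ) :=
  ENNReal.ofReal (1 - ε) • unifSquare + ENNReal.ofReal ε • unifGraph f

/-- The law of an i.i.d. sample of size `n` from `P`. -/
def sampleLaw (n : ℕ) (P : Measure (ℝ × ℝ)) : Measure (Fin n → ℝ × ℝ) :=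
  Measure.pi fun _ => P

/-! ### Multiscale anisotropic strips -/

/-- `J = ⌈log₂ n⌉`. -/
def dyadicLog (n : ℕ) : ℕ := Nat.clog 2 n

/-- The width `w = 2^{-j}`. -/
def width (j : ℕ) : ℝ := (2 : ℝ) ^ (-(j : ℤ))

/-- The thickness `t = 2^{-(J-j)+1}`. -/
def thick (n j : ℕ) : ℝ := (2 : ℝ) ^ (-((dyadicLog n : ℤ) - (j : ℤ)) + 1)

/-- The vertical spacing `δ₁ = t/4`. -/
def delta1 (n j : ℕ) : ℝ := thick n j / 4

/-- The slope spacing `δ₂ = t/(4w)`. -/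
def delta2 (n j : ℕ) : ℝ := thick n j / (4 * width j)

/-- The discrete parameters `(k, ℓ₁, ℓ₂)` of a strip. -/
structure StripIndex where
  k : ℕ
  l1 : ℤ
  l2 : ℤ

/-- The admissible parameters at scale `j`: `0 ≤ k < w⁻¹`, `0 ≤ ℓ₁ ≤ δ₁⁻¹ - 1` and
`-S δ₂⁻¹ ≤ ℓ₂ ≤ S δ₂⁻¹`. They are the vertices of the graph of scale `j`. -/
structure IsVertex (S : ℝ) (n j : ℕ) (v : StripIndex) : Prop where
  k_lt : (v.k : ℝ) < (width j)⁻¹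
  l1_nonneg : 0 ≤ v.l1
  l1_le : (v.l1 : ℝ) ≤ (delta1 n j)⁻¹ - 1
  l2_le : |(v.l2 : ℝ)| ≤ S * (delta2 n j)⁻¹

/-- The parallelogram with vertical sides, of width `w` and vertical thickness `t`, lying over
`[kw, (k+1)w)`, whose midline passes through `((k + 1/2) w, ℓ₁ δ₁)` with slope `ℓ₂ δ₂`. -/
def strip (n j : ℕ) (v : StripIndex) : Set (ℝ × ℝ) :=
  {p | (v.k : ℝ) * width j ≤ p.1 ∧ p.1 < ((v.k : ℝ) + 1) * width j ∧
    |p.2 - ((v.l1 : ℝ) * delta1 n j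
      + (v.l2 : ℝ) * delta2 n j * (p.1 - ((v.k : ℝ) + 1 / 2) * width j))| ≤ thick n j / 2}

/-- The directed edges `(k, ℓ₁, ℓ₂) ↦ (k + 1, ℓ₁ + ℓ₂ + u, ℓ₂ + v)` with `|u|, |v| ≤ 4`. -/
def GoodContinuation (a b : StripIndex) : Prop :=
  b.k = a.k + 1 ∧ |b.l1 - (a.l1 + a.l2)| ≤ 4 ∧ |b.l2 - a.l2| ≤ 4

/-! ### The significant-runs test -/

/-- `N(R)`: the number of data points in `R`. -/
def count {n : ℕ} (x : Fin n → ℝ × ℝ) (R : Set (ℝ × ℝ)) : ℕ := {i | x i ∈ R}.ncard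

/-- A significant path `(R₁, …, R_m)` at scale `j`: vertices of the graph of scale `j`, each with
a count exceeding `N`, consecutive ones being joined by an edge. -/
structure IsSigPath (S : ℝ) (N : ℕ) {n : ℕ} (x : Fin n → ℝ × ℝ) (j : ℕ)
    (π : List StripIndex) : Prop where
  vertex : ∀ v ∈ π, IsVertex S n j v
  significant : ∀ v ∈ π, N < count x (strip n j v)
  connected : π.IsChain GoodContinuation

/-- `L_{n,j}^max`: the largest number of strips in a significant path at scale `j`. -/
def longestRunAt (S : ℝ) (N : ℕ) {n : ℕ} (x : Fin n → ℝ × ℝ) (j : ℕ) : ℕ :=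
  sSup {m | ∃ π : List StripIndex, IsSigPath S N x j π ∧ π.length = m}

/-- `L_n^max`: the maximum of `L_{n,j}^max` over the scales `0 ≤ j ≤ J`. -/
def longestRun (S : ℝ) (N : ℕ) {n : ℕ} (x : Fin n → ℝ × ℝ) : ℕ :=
  (Finset.range (dyadicLog n + 1)).sup (longestRunAt S N x)

/-- The samples of size `n` for which the test with thresholds `N`, `L` rejects. -/
def rejects (S : ℝ) (N : ℕ) (L : ℝ) (n : ℕ) : Set (Fin n → ℝ × ℝ) :=
  {x | L < (longestRun S N x : ℝ)}

/-! ### The thresholds -/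

/-- `N` is an admissible count threshold for `p₀`: `P(Poisson(2) > N) ≤ p₀ / 162`. -/
def IsCountThreshold (p₀ : ℝ) (N : ℕ) : Prop :=
  poissonMeasure 2 (Ioi N) ≤ ENNReal.ofReal (p₀ / 162)

/-- `L_n^* = 3 log_{p₀}(n)`, the logarithm being to the base `1/p₀`. -/
def runThreshold (p₀ : ℝ) (n : ℕ) : ℝ := 3 * Real.logb (1 / p₀) n

/-! ### The maximal path length is a true maximum -/

theorem chain_length_le (M : ℕ) : ∀ (a : StripIndex) (l : List StripIndex),
    (a :: l).IsChain GoodContinuation → (∀ v ∈ a :: l, v.k < M) → a.k + (a :: l).length ≤ M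
  | a, [], _, h => by
      have := h a (by simp)
      simp only [List.length_cons, List.length_nil]
      omega
  | a, b :: l, hc, h => by
      rw [List.isChain_cons_cons] at hc
      have h1 := chain_length_le M b l hc.2 (fun v hv => h v (List.mem_cons_of_mem _ hv))
      have h2 := hc.1.1
      simp only [List.length_cons] at h1 ⊢
      omega

theorem IsSigPath.length_le {S : ℝ} {N n : ℕ} {x : Fin n → ℝ × ℝ} {j : ℕ}
    {π : List StripIndex} (h : IsSigPath S N x j π) : π.length ≤ 2 ^ j := by
  cases π with
  | nil => simp
  | cons a l =>
    have h1 := chain_length_le (2 ^ j) a l h.connected (fun v hv => by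
      have h2 := (h.vertex v hv).k_lt
      simp only [width, zpow_neg, inv_inv, zpow_natCast] at h2
      exact_mod_cast h2)
    omega

theorem lt_longestRun_iff {S : ℝ} {N n : ℕ} {x : Fin n → ℝ × ℝ} {m : ℕ} :
    m < longestRun S N x ↔
      ∃ j ≤ dyadicLog n, ∃ π : List StripIndex, IsSigPath S N x j π ∧ m < π.length := by
  rw [longestRun, Finset.lt_sup_iff]
  constructor
  · rintro ⟨j, hj, hm⟩
    have hne : {m | ∃ π : List StripIndex, IsSigPath S N x j π ∧ π.length = m}.Nonempty :=
      ⟨0, [], ⟨by simp, by simp, by simp⟩, rfl⟩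
    obtain ⟨m', ⟨π, hπ, rfl⟩, hlt⟩ := exists_lt_of_lt_csSup hne hm
    exact ⟨j, by simpa [Nat.lt_succ_iff] using hj, π, hπ, hlt⟩
  · rintro ⟨j, hj, π, hπ, hlt⟩
    refine ⟨j, by simpa [Nat.lt_succ_iff] using hj, hlt.trans_le (le_csSup ⟨2 ^ j, ?_⟩ ⟨π, hπ, rfl⟩)⟩
    rintro _ ⟨π', hπ', rfl⟩
    exact hπ'.length_le

end

end SigRuns

/-! Counts of an i.i.d. sample in disjoint sets are occupancy numbers of `n` balls thrown into cells
(`sampleLaw_count_mem`). These are negatively associated (`occupancy_prod_le`): a ball lands in at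
most one block of cells, so for nonnegative block statistics, all increasing or all decreasing, the
expected product is at most the product of the expectations. Both halves of the theorem use this.

Null hypothesis. Strips have area at most 2/n at every scale, so a strip is significant with
probability at most a binomial tail converging to the Poisson(2) tail, hence eventually at most
p₀/81. The strips of a path lie in different columns, so a given path of m + 1 strips is significant
with probability at most (p₀/81)^(m+1). A strip has at most 81 continuations, and there are O(n²)
strips per scale and O(log n) scales; the union bound is O(n² log n) p₀^(m+1), and m + 1 > L_n^*
makes the last factor at most n⁻³.

Alternative. At a scale of width w of order n^(-1/(1+α)) the Taylor error 2βw^α is at most t/8.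
Rounding the value and slope of f at the middle of each column then gives a strip containing the
graph over that column (`Follows.mem_strip`), and consecutive such strips are joined by edges
(`Follows.goodContinuation`). Each has probability at least θ/n, with θ proportional to τ. Take
about n^(1/4) disjoint blocks of K = ⌊L_n^*⌋ + 1 consecutive columns. For θ large a strip is
significant with probability at least p₀^(1/36), whose K-th power is at least of order n^(-1/12).
Negative association points the wrong way for bounding a whole block from below, so there the counts
are compared with independent binomials at a cost n(Kθ/n)² (`prod_binTail_le`). Failure of a block
is a decreasing statistic, so negative association applies across blocks: all fail with probability
at most exp(-const · n^(1/6)). Only the class constants of f and the lower bound on ε enter, whence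
the uniformity. -/

namespace SigRuns

/-! ### Elementary product inequalities -/

/-- When a factor is added, the discarded cross terms contain two of the `e i` and nonnegative
factors; they are nonnegative because the `e i` share a sign. This is the one-ball step of negative
association. -/
theorem prod_add_sum_erase_le {ι : Type*} [DecidableEq ι] (s : Finset ι) (u e : ι → ℝ)
    (hu : ∀ i, 0 ≤ u i) (hue : ∀ i, 0 ≤ u i + e i) (he : (∀ i, 0 ≤ e i) ∨ ∀ i, e i ≤ 0) :
    ∏ i ∈ s, u i + ∑ i ∈ s, e i * ∏ j ∈ s.erase i, u j ≤ ∏ i ∈ s, (u i + e i) := by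
  induction s using Finset.induction_on with
  | empty => simp
  | insert a s ha ih =>
    have herase : ∀ i ∈ s, e i * ∏ j ∈ (insert a s).erase i, u j
        = u a * (e i * ∏ j ∈ s.erase i, u j) := by
      intro i hi
      have hne : a ≠ i := fun h => ha (h ▸ hi)
      rw [Finset.erase_insert_of_ne hne, Finset.prod_insert (by simp [ha])]
      ring
    rw [Finset.prod_insert ha, Finset.prod_insert ha, Finset.sum_insert ha,
      Finset.erase_insert ha, Finset.sum_congr rfl herase, ← Finset.mul_sum]
    have h1 := mul_le_mul_of_nonneg_left ih (hue a)
    have h2 : 0 ≤ e a * ∑ i ∈ s, e i * ∏ j ∈ s.erase i, u j := by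
      rcases he with he | he
      · exact mul_nonneg (he a) (Finset.sum_nonneg fun i _ =>
          mul_nonneg (he i) (Finset.prod_nonneg fun j _ => hu j))
      · exact mul_nonneg_of_nonpos_of_nonpos (he a) (Finset.sum_nonpos fun i _ =>
          mul_nonpos_of_nonpos_of_nonneg (he i) (Finset.prod_nonneg fun j _ => hu j))
    linarith

/-- A converse up to second order: each new factor creates a cross term of at most `s.card * q ^ 2`,
and these add up to less than the stated square. -/
theorem prod_add_mul_le {ι : Type*} [DecidableEq ι] (s : Finset ι) (u d : ι → ℝ) (q : ℝ)
    (hq0 : 0 ≤ q) (hq1 : q ≤ 1) (hu : ∀ i, 0 ≤ u i) (hd : ∀ i, 0 ≤ d i)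
    (hud : ∀ i, u i + d i ≤ 1) :
    ∏ i ∈ s, (u i + q * d i)
      ≤ ∏ i ∈ s, u i + ∑ i ∈ s, q * d i * ∏ j ∈ s.erase i, u j + ((s.card : ℝ) * q) ^ 2 := by
  induction s using Finset.induction_on with
  | empty => simp
  | insert a s ha ih =>
    have herase : ∀ i ∈ s, q * d i * ∏ j ∈ (insert a s).erase i, u j
        = u a * (q * d i * ∏ j ∈ s.erase i, u j) := by
      intro i hi
      have hne : a ≠ i := fun h => ha (h ▸ hi)
      rw [Finset.erase_insert_of_ne hne, Finset.prod_insert (by simp [ha])]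
      ring
    rw [Finset.prod_insert ha, Finset.prod_insert ha, Finset.sum_insert ha,
      Finset.erase_insert ha, Finset.sum_congr rfl herase, ← Finset.mul_sum,
      Finset.card_insert_of_notMem ha]
    set P := ∏ i ∈ s, u i
    set T := ∑ i ∈ s, q * d i * ∏ j ∈ s.erase i, u j with hT
    have hu1 : ∀ i, u i ≤ 1 := fun i => by linarith [hd i, hud i]
    have hd1 : ∀ i, d i ≤ 1 := fun i => by linarith [hu i, hud i]
    have hTle : T ≤ s.card * q := by
      rw [← nsmul_eq_mul, ← Finset.sum_const, hT]
      refine Finset.sum_le_sum fun i _ => ?_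
      have h0 : ∏ j ∈ s.erase i, u j ≤ 1 :=
        Finset.prod_le_one (fun j _ => hu j) (fun j _ => hu1 j)
      have h1 : 0 ≤ q * d i := mul_nonneg hq0 (hd i)
      nlinarith [hd1 i]
    have h0 : 0 ≤ u a + q * d a := add_nonneg (hu a) (mul_nonneg hq0 (hd a))
    have h1 : u a + q * d a ≤ 1 := by nlinarith [hd a, hud a]
    have h2 := mul_le_mul_of_nonneg_left ih h0
    have h3 : (u a + q * d a) * ((s.card : ℝ) * q) ^ 2 ≤ ((s.card : ℝ) * q) ^ 2 :=
      mul_le_of_le_one_left (sq_nonneg _) h1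
    have h4 : q * d a * T ≤ q * (s.card * q) := by
      have hs : 0 ≤ (s.card : ℝ) * q := by positivity
      calc q * d a * T ≤ q * d a * (s.card * q) :=
            mul_le_mul_of_nonneg_left hTle (mul_nonneg hq0 (hd a))
        _ ≤ q * (s.card * q) := by
            refine mul_le_mul_of_nonneg_right ?_ hs
            nlinarith [hd1 a]
    have h5 : ((s.card + 1 : ℕ) * q : ℝ) ^ 2
        = ((s.card : ℝ) * q) ^ 2 + q * (s.card * q) + (q * (s.card * q) + q ^ 2) := by
      push_cast; ring
    have h6 : 0 ≤ q * (s.card * q) + q ^ 2 := by positivity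
    rw [h5]
    nlinarith

/-! ### Occupancy numbers -/

section Occupancy

variable {I : Type*} [Fintype I] [DecidableEq I]

/-- The expectation of `φ` at the occupancy numbers obtained by throwing `n` balls independently
into the cells `I`, cell `i` being hit with probability `q i` (and no cell with the remaining
probability), starting from the occupancy numbers `c`. -/
noncomputable def occupancy (q : I → ℝ) (φ : (I → ℕ) → ℝ) : ℕ → (I → ℕ) → ℝ
  | 0, c => φ c
  | n + 1, c => ∑ i, q i * occupancy q φ n (c + Pi.single i 1)
      + (1 - ∑ i, q i) * occupancy q φ n c

/-- Isolates the effect of one ball as a sum of increments, whose sign is known for monotone `φ`. -/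
theorem occupancy_succ' (q : I → ℝ) (φ : (I → ℕ) → ℝ) (n : ℕ) (c : I → ℕ) :
    occupancy q φ (n + 1) c = occupancy q φ n c
      + ∑ i, q i * (occupancy q φ n (c + Pi.single i 1) - occupancy q φ n c) := by
  simp only [occupancy, mul_sub, Finset.sum_sub_distrib, ← Finset.sum_mul]
  ring

variable {q : I → ℝ} (hq : ∀ i, 0 ≤ q i) (hq1 : ∑ i, q i ≤ 1)

include hq hq1

theorem occupancy_mono {φ ψ : (I → ℕ) → ℝ} (h : ∀ c, φ c ≤ ψ c) (n : ℕ) (c : I → ℕ) :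
    occupancy q φ n c ≤ occupancy q ψ n c := by
  induction n generalizing c with
  | zero => exact h c
  | succ n ih =>
    exact add_le_add (Finset.sum_le_sum fun i _ => mul_le_mul_of_nonneg_left (ih _) (hq i))
      (mul_le_mul_of_nonneg_left (ih _) (by linarith))

omit hq hq1 in
theorem occupancy_const (a : ℝ) (n : ℕ) (c : I → ℕ) : occupancy q (fun _ => a) n c = a := by
  induction n generalizing c with
  | zero => rfl
  | succ n ih => rw [occupancy_succ']; simp [ih]

theorem occupancy_nonneg {φ : (I → ℕ) → ℝ} (h : ∀ c, 0 ≤ φ c) (n : ℕ) (c : I → ℕ) :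
    0 ≤ occupancy q φ n c :=
  (occupancy_const 0 n c).symm.le.trans (occupancy_mono hq hq1 h n c)

theorem occupancy_le_one {φ : (I → ℕ) → ℝ} (h : ∀ c, φ c ≤ 1) (n : ℕ) (c : I → ℕ) :
    occupancy q φ n c ≤ 1 :=
  (occupancy_mono hq hq1 h n c).trans (occupancy_const 1 n c).le

theorem occupancy_monotone {φ : (I → ℕ) → ℝ} (h : Monotone φ) (n : ℕ) :
    Monotone (occupancy q φ n) := by
  induction n with
  | zero => exact h
  | succ n ih =>
    intro c c' hc
    exact add_le_add (Finset.sum_le_sum fun i _ =>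
        mul_le_mul_of_nonneg_left (ih (add_le_add_left hc _)) (hq i))
      (mul_le_mul_of_nonneg_left (ih hc) (by linarith))

omit hq hq1 in
theorem occupancy_neg (φ : (I → ℕ) → ℝ) (n : ℕ) (c : I → ℕ) :
    occupancy q (fun c => -φ c) n c = -occupancy q φ n c := by
  induction n generalizing c with
  | zero => rfl
  | succ n ih => simp only [occupancy, ih, mul_neg, Finset.sum_neg_distrib]; ring

omit hq hq1 in
theorem occupancy_one_sub (φ : (I → ℕ) → ℝ) (n : ℕ) (c : I → ℕ) :
    occupancy q (fun c => 1 - φ c) n c = 1 - occupancy q φ n c := by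
  induction n generalizing c with
  | zero => rfl
  | succ n ih => simp only [occupancy, ih, mul_sub, mul_one, Finset.sum_sub_distrib]; ring

theorem occupancy_antitone {φ : (I → ℕ) → ℝ} (h : Antitone φ) (n : ℕ) :
    Antitone (occupancy q φ n) := by
  intro c c' hc
  have h1 := occupancy_monotone hq hq1 (φ := fun c => -φ c) (fun a b hab => neg_le_neg (h hab)) n hc
  rw [occupancy_neg, occupancy_neg] at h1
  exact neg_le_neg_iff.1 h1

omit hq1 in
-- By induction `q` is replaced by `q'` in the later throws; in the current throw the weights
-- multiply increments that are nonnegative since `φ` is increasing.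
theorem occupancy_mono_prob {q' : I → ℝ} (hqq : ∀ i, q i ≤ q' i) (hq1' : ∑ i, q' i ≤ 1)
    {φ : (I → ℕ) → ℝ} (h : Monotone φ) (n : ℕ) (c : I → ℕ) :
    occupancy q φ n c ≤ occupancy q' φ n c := by
  have hq1 : ∑ i, q i ≤ 1 := (Finset.sum_le_sum fun i _ => hqq i).trans hq1'
  induction n generalizing c with
  | zero => rfl
  | succ n ih =>
    calc occupancy q φ (n + 1) c
        ≤ ∑ i, q i * occupancy q' φ n (c + Pi.single i 1)
            + (1 - ∑ i, q i) * occupancy q' φ n c :=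
          add_le_add (Finset.sum_le_sum fun i _ => mul_le_mul_of_nonneg_left (ih _) (hq i))
            (mul_le_mul_of_nonneg_left (ih _) (by linarith))
      _ = occupancy q' φ n c
            + ∑ i, q i * (occupancy q' φ n (c + Pi.single i 1) - occupancy q' φ n c) := by
          simp only [mul_sub, Finset.sum_sub_distrib, ← Finset.sum_mul]
          ring
      _ ≤ occupancy q' φ (n + 1) c := by
          rw [occupancy_succ']
          refine add_le_add_right (Finset.sum_le_sum fun i _ =>
            mul_le_mul_of_nonneg_right (hqq i) (sub_nonneg.2 ?_)) _
          exact occupancy_monotone (fun i => (hq i).trans (hqq i)) hq1' h n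
            (le_add_of_nonneg_right (by simp))

end Occupancy

/-- Negative association of the occupancy numbers: monotone statistics of disjoint blocks of cells,
all increasing or all decreasing, are at most as correlated as if they were independent. -/
theorem occupancy_prod_le {B K : Type*} [Fintype B] [DecidableEq B] [Fintype K] [DecidableEq K]
    {q : B × K → ℝ} (hq : ∀ i, 0 ≤ q i) (hq1 : ∑ i, q i ≤ 1)
    {φ : B → (K → ℕ) → ℝ} (hφ0 : ∀ b c, 0 ≤ φ b c)
    (hφ : (∀ b, Monotone (φ b)) ∨ ∀ b, Antitone (φ b)) (n : ℕ) (c : B × K → ℕ) :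
    occupancy q (fun c => ∏ b, φ b fun k => c (b, k)) n c
      ≤ ∏ b, occupancy (fun k => q (b, k)) (φ b) n fun k => c (b, k) := by
  have hqb : ∀ b, ∑ k, q (b, k) ≤ 1 := fun b =>
    (Finset.single_le_sum (f := fun b => ∑ k, q (b, k))
      (fun b _ => Finset.sum_nonneg fun k _ => hq (b, k)) (Finset.mem_univ b)).trans
      (by rwa [← Fintype.sum_prod_type])
  induction n generalizing c with
  | zero => exact le_rfl
  | succ n ih =>
    set u : B → (K → ℕ) → ℝ := fun b => occupancy (fun k => q (b, k)) (φ b) n with hu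
    have hu0 : ∀ b c, 0 ≤ u b c := fun b c =>
      occupancy_nonneg (fun k => hq (b, k)) (hqb b) (hφ0 b) n c
    set e : B → ℝ := fun b => ∑ k, q (b, k) *
      (u b ((fun k => c (b, k)) + Pi.single k 1) - u b fun k => c (b, k)) with he
    have hstep : ∀ b, occupancy (fun k => q (b, k)) (φ b) (n + 1) (fun k => c (b, k))
        = u b (fun k => c (b, k)) + e b := fun b => occupancy_succ' _ _ _ _
    -- A ball in cell `(b, k)` changes only the factor of block `b`.
    have hprod : ∀ i : B × K, ∏ b, u b (fun k => (c + Pi.single i 1 : B × K → ℕ) (b, k))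
        = u i.1 ((fun k => c (i.1, k)) + Pi.single i.2 1)
          * ∏ b ∈ Finset.univ.erase i.1, u b fun k => c (b, k) := by
      rintro ⟨b, k⟩
      rw [← Finset.mul_prod_erase _ _ (Finset.mem_univ b)]
      congr 1
      · congr 1
        ext k'
        simp [Pi.single_apply]
      · refine Finset.prod_congr rfl fun b' hb' => ?_
        congr 1
        ext k'
        have : (b', k') ≠ (b, k) := fun h => (Finset.ne_of_mem_erase hb') (Prod.ext_iff.1 h).1
        simp [this]
    simp_rw [hstep]
    -- One throw acts on the product exactly to first order in `e`, since at most one block is hit;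
    -- on the right-hand side every block receives its own increment `e b`.
    refine le_trans ?_ (prod_add_sum_erase_le Finset.univ (fun b => u b fun k => c (b, k)) e
      (fun b => hu0 b _) (fun b => ?_) ?_)
    · calc _ ≤ ∑ i, q i * (∏ b, u b fun k => (c + Pi.single i 1 : B × K → ℕ) (b, k))
            + (1 - ∑ i, q i) * ∏ b, u b fun k => c (b, k) :=
            add_le_add (Finset.sum_le_sum fun i _ => mul_le_mul_of_nonneg_left (ih _) (hq i))
              (mul_le_mul_of_nonneg_left (ih _) (by linarith))
        _ = ∏ b, u b (fun k => c (b, k)) + ∑ i : B × K,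
              q i * ((u i.1 ((fun k => c (i.1, k)) + Pi.single i.2 1) - u i.1 fun k => c (i.1, k))
                * ∏ b ∈ Finset.univ.erase i.1, u b fun k => c (b, k)) := by
            have : ∀ i : B × K, q i * (∏ b, u b fun k => (c + Pi.single i 1 : B × K → ℕ) (b, k))
                = q i * (∏ b, u b fun k => c (b, k)) + q i *
                  ((u i.1 ((fun k => c (i.1, k)) + Pi.single i.2 1) - u i.1 fun k => c (i.1, k))
                * ∏ b ∈ Finset.univ.erase i.1, u b fun k => c (b, k)) := by
              intro i
              rw [hprod, ← Finset.mul_prod_erase _ (fun b => u b fun k => c (b, k))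
                (Finset.mem_univ i.1)]
              ring
            rw [Finset.sum_congr rfl fun i _ => this i, Finset.sum_add_distrib, ← Finset.sum_mul]
            ring
        _ = _ := by
            rw [Fintype.sum_prod_type]
            simp only [he, Finset.sum_mul, mul_assoc]
    · rw [← hstep b]
      exact occupancy_nonneg (fun k => hq (b, k)) (hqb b) (hφ0 b) _ _
    · have hle : ∀ (b : B) (k : K), (fun k => c (b, k)) ≤ (fun k => c (b, k)) + Pi.single k 1 :=
        fun b k => le_add_of_nonneg_right (by simp)
      rcases hφ with hφ | hφ
      · exact .inl fun b => Finset.sum_nonneg fun k _ => mul_nonneg (hq _) (sub_nonneg.2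
          (occupancy_monotone (fun k => hq (b, k)) (hqb b) (hφ b) n (hle b k)))
      · exact .inr fun b => Finset.sum_nonpos fun k _ =>
          mul_nonpos_of_nonneg_of_nonpos (hq _) (sub_nonpos.2
          (occupancy_antitone (fun k => hq (b, k)) (hqb b) (hφ b) n (hle b k)))

/-! ### Binomial tails -/

/-- The probability that `s` plus a binomial variable with parameters `n` and `q` exceeds `N`. -/
noncomputable def binTail (q : ℝ) (N n s : ℕ) : ℝ :=
  occupancy (fun _ : Unit => q) (fun c => if N < c () then 1 else 0) n fun _ => s

theorem binTail_zero (q : ℝ) (N s : ℕ) : binTail q N 0 s = if N < s then 1 else 0 := rfl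

theorem binTail_succ (q : ℝ) (N n s : ℕ) :
    binTail q N (n + 1) s = q * binTail q N n (s + 1) + (1 - q) * binTail q N n s := by
  have : (fun _ : Unit => s) + Pi.single () 1 = fun _ => s + 1 := by ext; simp
  simp [binTail, occupancy, this]

theorem monotone_ite_lt {K : Type*} (N : ℕ) (k : K) :
    Monotone fun c : K → ℕ => if N < c k then (1 : ℝ) else 0 := by
  intro c c' h
  have := h k
  by_cases h1 : N < c k
  · simp [h1, h1.trans_le this]
  · simp only [h1, if_false]
    positivity

section

variable {q : ℝ} (hq0 : 0 ≤ q) (hq1 : q ≤ 1)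

include hq0 hq1

theorem binTail_nonneg (N n s : ℕ) : 0 ≤ binTail q N n s :=
  occupancy_nonneg (fun _ => hq0) (by simpa using hq1) (fun c => by positivity) n _

theorem binTail_le_one (N n s : ℕ) : binTail q N n s ≤ 1 :=
  occupancy_le_one (fun _ => hq0) (by simpa using hq1) (fun c => by split_ifs <;> norm_num) n _

theorem binTail_le_succ (N n s : ℕ) : binTail q N n s ≤ binTail q N n (s + 1) :=
  occupancy_monotone (fun _ => hq0) (by simpa using hq1) (monotone_ite_lt N ()) n
    (fun _ => Nat.le_succ s)

/-- Chernoff's bound with the moment `E 2^(-X) = (1 - q/2)^n` of a binomial variable `X`, proved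
along the recursion. -/
theorem one_sub_binTail_le (N n s : ℕ) :
    1 - binTail q N n s ≤ 2 ^ (N + 1) * (1 / 2) ^ s * (1 - q / 2) ^ n := by
  induction n generalizing s with
  | zero =>
    rw [binTail_zero]
    split_ifs with h
    · simp only [sub_self]; positivity
    · have h1 : (1 / 2 : ℝ) ^ (N + 1) ≤ (1 / 2) ^ s :=
        pow_le_pow_of_le_one (by norm_num) (by norm_num) (by omega)
      have h2 : (2 : ℝ) ^ (N + 1) * (1 / 2) ^ (N + 1) = 1 := by rw [← mul_pow]; norm_num
      have h3 : (0 : ℝ) ≤ 2 ^ (N + 1) := by positivity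
      nlinarith
  | succ n ih =>
    have h1 := mul_le_mul_of_nonneg_left (ih (s + 1)) hq0
    have h2 := mul_le_mul_of_nonneg_left (ih s) (sub_nonneg.2 hq1)
    rw [binTail_succ]
    calc _ = q * (1 - binTail q N n (s + 1)) + (1 - q) * (1 - binTail q N n s) := by ring
      _ ≤ _ := add_le_add h1 h2
      _ = _ := by ring

end

/-- Pascal's rule: the binomial distribution function obeys the same recursion as `binTail`. -/
theorem sum_choose_succ (q : ℝ) (n M : ℕ) :
    ∑ i ∈ Finset.range (M + 1), ((n + 1).choose i : ℝ) * q ^ i * (1 - q) ^ (n + 1 - i)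
      = q * ∑ i ∈ Finset.range M, (n.choose i : ℝ) * q ^ i * (1 - q) ^ (n - i)
        + (1 - q) * ∑ i ∈ Finset.range (M + 1), (n.choose i : ℝ) * q ^ i * (1 - q) ^ (n - i) := by
  rw [Finset.sum_range_succ', Finset.sum_range_succ' _ M, mul_add, Finset.mul_sum,
    Finset.mul_sum, ← add_assoc, ← Finset.sum_add_distrib]
  congr 1
  · refine Finset.sum_congr rfl fun i _ => ?_
    rw [Nat.choose_succ_succ, Nat.add_sub_add_right]
    rcases Nat.lt_or_ge i n with h | h
    · obtain ⟨m, rfl⟩ := Nat.exists_eq_add_of_lt h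
      have h1 : i + m + 1 - i = m + 1 := by omega
      have h2 : i + m + 1 - (i + 1) = m := by omega
      rw [h1, h2]; push_cast; ring
    · rw [Nat.choose_eq_zero_of_lt (by omega : n < i + 1)]; push_cast; ring
  · simp [pow_succ']

/-- The truncated subtraction is intended: for `s > N` the sum is empty and the tail is 1. -/
theorem binTail_eq (q : ℝ) (N n s : ℕ) : binTail q N n s =
    1 - ∑ i ∈ Finset.range (N + 1 - s), (n.choose i : ℝ) * q ^ i * (1 - q) ^ (n - i) := by
  induction n generalizing s with
  | zero =>
    rw [binTail_zero]
    split_ifs with h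
    · simp [show N + 1 - s = 0 by omega]
    · obtain ⟨m, hm⟩ : ∃ m, N + 1 - s = m + 1 := ⟨N - s, by omega⟩
      rw [hm, Finset.sum_range_succ']
      simp
  | succ n ih =>
    rw [binTail_succ, ih, ih]
    rcases Nat.lt_or_ge N s with h | h
    · simp [show N + 1 - s = 0 by omega, show N + 1 - (s + 1) = 0 by omega]
    · obtain ⟨m, hm⟩ : ∃ m, N + 1 - s = m + 1 := ⟨N - s, by omega⟩
      rw [hm, show N + 1 - (s + 1) = m by omega, sum_choose_succ]
      ring

theorem tendsto_binTail (N : ℕ) : Tendsto (fun n : ℕ => binTail (2 / n) N n 0) atTop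
    (𝓝 (1 - ∑ i ∈ Finset.range (N + 1), Real.exp (-2) * 2 ^ i / i.factorial)) := by
  simp_rw [binTail_eq]
  refine tendsto_const_nhds.sub (tendsto_finsetSum _ fun i _ =>
    tendsto_choose_mul_pow_of_tendsto_mul_atTop i ?_)
  refine tendsto_const_nhds.congr' ?_
  filter_upwards [eventually_ne_atTop 0] with n hn
  field

theorem poissonMeasure_real_Ioi (N : ℕ) : (poissonMeasure 2).real (Ioi N)
    = 1 - ∑ i ∈ Finset.range (N + 1), Real.exp (-2) * 2 ^ i / i.factorial := by
  have h1 : (poissonMeasure 2).real (↑(Finset.range (N + 1)) : Set ℕ)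
      = ∑ i ∈ Finset.range (N + 1), Real.exp (-2) * 2 ^ i / i.factorial := by
    rw [← sum_measureReal_singleton]
    simp [poissonMeasure_real_singleton]
  have h2 : Ioi N = (↑(Finset.range (N + 1)) : Set ℕ)ᶜ := by
    ext i; rw [mem_compl_iff, Finset.mem_coe, Finset.mem_range, mem_Ioi]; omega
  rw [← h1, h2, probReal_compl_eq_one_sub .of_discrete]

theorem exists_isCountThreshold {p₀ : ℝ} (hp : 0 < p₀) : ∃ N : ℕ, IsCountThreshold p₀ N := by
  have h1 : Tendsto (fun N : ℕ => (poissonMeasure 2).real (Ioi N)) atTop (𝓝 0) := by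
    have h2 := (hasSum_one_poissonMeasure 2).tendsto_sum_nat
    have h3 := (tendsto_const_nhds (x := (1 : ℝ))).sub (h2.comp (tendsto_add_atTop_nat 1))
    rw [sub_self] at h3
    refine h3.congr fun N => ?_
    rw [poissonMeasure_real_Ioi]
    simp
  obtain ⟨N, hN⟩ := (h1.eventually (Iic_mem_nhds (show 0 < p₀ / 162 by positivity))).exists
  refine ⟨N, ?_⟩
  rw [IsCountThreshold, ← ofReal_measureReal]
  exact ENNReal.ofReal_le_ofReal hN

/-- The factor 2 between 162 and 81 absorbs the error in the Poisson limit. -/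
theorem IsCountThreshold.eventually_binTail_le {p₀ : ℝ} {N : ℕ} (h : IsCountThreshold p₀ N)
    (hp : 0 < p₀) : ∀ᶠ n : ℕ in atTop, binTail (2 / n) N n 0 ≤ p₀ / 81 := by
  refine (tendsto_binTail N).eventually (Iic_mem_nhds ?_)
  rw [← poissonMeasure_real_Ioi]
  have h1 : (poissonMeasure 2).real (Ioi N) ≤ p₀ / 162 :=
    ENNReal.toReal_le_of_le_ofReal (by positivity) h
  linarith

/-- Up to an error term, occupancy numbers are at least as likely to be simultaneously large as
independent binomial variables. -/
theorem prod_binTail_le {K : Type*} [Fintype K] [DecidableEq K] {q : ℝ} (hq0 : 0 ≤ q)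
    (hq1 : Fintype.card K * q ≤ 1) (hK : 0 < Fintype.card K) (N n : ℕ) (c : K → ℕ) :
    ∏ k, binTail q N n (c k) - n * (Fintype.card K * q) ^ 2
      ≤ occupancy (fun _ : K => q) (fun c => ∏ k, if N < c k then 1 else 0) n c := by
  have hq2 : q ≤ 1 := by
    have : (1 : ℝ) ≤ Fintype.card K := by exact_mod_cast hK
    nlinarith
  induction n generalizing c with
  | zero => simp [binTail_zero, occupancy]
  | succ n ih =>
    have hupd : ∀ i, ∏ k, binTail q N n ((c + Pi.single i 1 : K → ℕ) k)
        = binTail q N n (c i + 1) * ∏ k ∈ Finset.univ.erase i, binTail q N n (c k) := by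
      intro i
      rw [← Finset.mul_prod_erase _ _ (Finset.mem_univ i)]
      congr 1
      · simp
      · refine Finset.prod_congr rfl fun k hk => ?_
        simp [Finset.ne_of_mem_erase hk]
    -- Independent binomials allow one throw to hit several cells; the resulting excess is of second
    -- order, at most `(card K * q) ^ 2` per throw.
    have h1 := prod_add_mul_le Finset.univ (fun k => binTail q N n (c k))
      (fun k => binTail q N n (c k + 1) - binTail q N n (c k)) q hq0 hq2
      (fun k => binTail_nonneg hq0 hq2 _ _ _)
      (fun k => sub_nonneg.2 (binTail_le_succ hq0 hq2 _ _ _))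
      (fun k => by simpa using binTail_le_one hq0 hq2 N n (c k + 1))
    have h2 : ∀ k, binTail q N (n + 1) (c k) = binTail q N n (c k)
        + q * (binTail q N n (c k + 1) - binTail q N n (c k)) := by
      intro k; rw [binTail_succ]; ring
    simp_rw [h2]
    set P := ∏ k, binTail q N n (c k) with hP
    set R := ∏ k, (binTail q N n (c k) + q * (binTail q N n (c k + 1) - binTail q N n (c k)))
    set δ := (n : ℝ) * (Fintype.card K * q) ^ 2
    have h3 : ∀ i, q * (binTail q N n (c i + 1) - binTail q N n (c i)) *
        ∏ k ∈ Finset.univ.erase i, binTail q N n (c k)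
        = q * ∏ k, binTail q N n ((c + Pi.single i 1 : K → ℕ) k) - q * P := by
      intro i
      rw [hupd, hP, ← Finset.mul_prod_erase _ (fun k => binTail q N n (c k)) (Finset.mem_univ i)]
      ring
    have h4 : ∑ i : K, q * (∏ k, binTail q N n ((c + Pi.single i 1 : K → ℕ) k) - δ)
        + (1 - ∑ _i : K, q) * (P - δ) ≤
        occupancy (fun _ : K => q) (fun c => ∏ k, if N < c k then 1 else 0) (n + 1) c :=
      add_le_add (Finset.sum_le_sum fun i _ => mul_le_mul_of_nonneg_left (ih _) hq0)
        (mul_le_mul_of_nonneg_left (ih _) (by simpa using hq1))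
    refine le_trans ?_ h4
    rw [Finset.sum_congr rfl fun i _ => h3 i] at h1
    simp only [Finset.sum_sub_distrib, Finset.sum_const, Finset.card_univ, nsmul_eq_mul,
      mul_sub] at h1 ⊢
    have h5 : ((n + 1 : ℕ) : ℝ) * (Fintype.card K * q) ^ 2 = δ + (Fintype.card K * q) ^ 2 := by
      simp only [δ]; push_cast; ring
    rw [h5]
    linarith

/-! ### Counts in an i.i.d. sample -/

open Classical in
theorem count_eq_sum {n : ℕ} (x : Fin n → ℝ × ℝ) (R : Set (ℝ × ℝ)) :
    count x R = ∑ i, if x i ∈ R then 1 else 0 := by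
  rw [count, Finset.sum_boole, Set.ncard_eq_toFinset_card']
  simp

theorem measurable_count {n : ℕ} {R : Set (ℝ × ℝ)} (hR : MeasurableSet R) :
    Measurable fun x : Fin n → ℝ × ℝ => count x R := by
  classical
  simp_rw [count_eq_sum]
  exact Finset.measurable_sum _ fun i _ =>
    Measurable.ite (measurable_pi_apply i hR) measurable_const measurable_const

open Classical in
theorem count_insertNth {n : ℕ} (y : ℝ × ℝ) (x : Fin n → ℝ × ℝ) (R : Set (ℝ × ℝ)) :
    count (Fin.insertNth (α := fun _ => ℝ × ℝ) 0 y x) R = (if y ∈ R then 1 else 0) + count x R := by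
  rw [count_eq_sum, count_eq_sum, Fin.sum_univ_succ]
  simp

theorem sum_measureReal_le_one {I : Type*} [Fintype I] (P : Measure (ℝ × ℝ))
    [IsProbabilityMeasure P] {A : I → Set (ℝ × ℝ)} (hA : ∀ i, MeasurableSet (A i))
    (hd : Pairwise (Function.onFun Disjoint A)) : ∑ i, P.real (A i) ≤ 1 := by
  rw [← measureReal_iUnion_fintype hd hA]
  exact measureReal_le_one

/-- The law of the numbers of sample points in disjoint sets is that of occupancy numbers. -/
theorem sampleLaw_count_mem {I : Type*} [Fintype I] [DecidableEq I] (P : Measure (ℝ × ℝ))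
    [IsProbabilityMeasure P] {A : I → Set (ℝ × ℝ)} (hA : ∀ i, MeasurableSet (A i))
    (hd : Pairwise (Function.onFun Disjoint A)) (Φ : Set (I → ℕ)) (n : ℕ) (c : I → ℕ) :
    sampleLaw n P {x | (fun i => c i + count x (A i)) ∈ Φ}
      = ENNReal.ofReal (occupancy (fun i => P.real (A i)) (Φ.indicator 1) n c) := by
  classical
  have hsum := sum_measureReal_le_one P hA hd
  induction n generalizing c with
  | zero =>
    have h0 : ∀ x : Fin 0 → ℝ × ℝ, ∀ R, count x R = 0 := fun x R => by simp [count_eq_sum]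
    have : IsProbabilityMeasure (sampleLaw 0 P) := by unfold sampleLaw; infer_instance
    by_cases hc : c ∈ Φ
    · simp [h0, occupancy, hc]
    · simp [h0, occupancy, hc]
  | succ n ih =>
    have hmeas : ∀ m : ℕ, ∀ c : I → ℕ, MeasurableSet
        {x : Fin m → ℝ × ℝ | (fun i => c i + count x (A i)) ∈ Φ} := fun m c =>
      (measurable_pi_lambda _ fun i => (measurable_count (hA i)).const_add (c i))
        (Set.to_countable Φ).measurableSet
    -- Fubini in the first sample point, which is then absorbed into the initial occupancy `c`;
    -- hence the induction over all `c`.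
    have hmp := measurePreserving_piFinSuccAbove (fun _ : Fin (n + 1) => P) 0
    have h1 := hmp.symm.measure_preimage (hmeas (n + 1) c).nullMeasurableSet
    unfold sampleLaw at ih ⊢
    rw [← h1, Measure.prod_apply ((hmp.symm.measurable) (hmeas (n + 1) c))]
    set g : (I → ℕ) → ENNReal := fun c =>
      ENNReal.ofReal (occupancy (fun i => P.real (A i)) (Φ.indicator 1) n c) with hg
    have h2 : ∀ y : ℝ × ℝ, (Measure.pi fun _ : Fin n => P) (Prod.mk y ⁻¹'
        ((MeasurableEquiv.piFinSuccAbove (fun _ : Fin (n + 1) => ℝ × ℝ) 0).symm ⁻¹'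
          {x | (fun i => c i + count x (A i)) ∈ Φ}))
        = g fun i => c i + if y ∈ A i then 1 else 0 := by
      intro y
      rw [hg]
      dsimp only
      rw [← ih]
      congr 1
      ext x
      simp only [mem_preimage, mem_ofPred_eq, MeasurableEquiv.piFinSuccAbove,
        MeasurableEquiv.coe_mk, MeasurableEquiv.symm_mk, Fin.insertNthEquiv]
      simp only [Equiv.symm_symm, Equiv.coe_fn_mk, count_insertNth, add_assoc]
    have h3 : ∀ y : ℝ × ℝ, (g fun i => c i + if y ∈ A i then 1 else 0)
        = ∑ i, (A i).indicator (fun _ => g (c + Pi.single i 1)) y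
          + (⋃ i, A i)ᶜ.indicator (fun _ => g c) y := by
      intro y
      by_cases hy : ∃ i, y ∈ A i
      · obtain ⟨i, hi⟩ := hy
        have hne : ∀ j, j ≠ i → y ∉ A j := fun j hj hyj =>
          Set.disjoint_left.1 (hd hj) hyj hi
        rw [Finset.sum_eq_single i (fun j _ hj => indicator_of_notMem (hne j hj) _) (by simp),
          indicator_of_mem hi, indicator_of_notMem (by simpa using ⟨_, hi⟩), add_zero]
        congr 1
        ext j
        rcases eq_or_ne j i with rfl | hj
        · simp [hi]
        · simp [hne j hj, hj]
      · push Not at hy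
        simp [hy]
    have hU : MeasurableSet (⋃ i, A i)ᶜ := (MeasurableSet.iUnion hA).compl
    simp_rw [h2, h3]
    rw [lintegral_add_right _ (measurable_const.indicator hU), lintegral_finsetSum _
      (fun i _ => measurable_const.indicator (hA i)), lintegral_indicator_const hU]
    simp_rw [lintegral_indicator_const (hA _)]
    have hnn : ∀ c, 0 ≤ occupancy (fun i => P.real (A i)) (Φ.indicator 1) n c :=
      occupancy_nonneg (fun i => measureReal_nonneg) hsum
        (fun c => indicator_nonneg (fun _ _ => zero_le_one) c) n
    rw [occupancy, ENNReal.ofReal_add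
      (Finset.sum_nonneg fun i _ => mul_nonneg measureReal_nonneg (hnn _))
      (mul_nonneg (by linarith) (hnn _)), ENNReal.ofReal_sum_of_nonneg
      (fun i _ => mul_nonneg measureReal_nonneg (hnn _)), ENNReal.ofReal_mul (by linarith)]
    congr 1
    · refine Finset.sum_congr rfl fun i _ => ?_
      rw [ENNReal.ofReal_mul measureReal_nonneg, ofReal_measureReal, mul_comm]
    · rw [mul_comm, ← ofReal_measureReal, probReal_compl_eq_one_sub (MeasurableSet.iUnion hA),
        measureReal_iUnion_fintype hd hA]

/-! ### Geometry of the strips -/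

theorem width_pos (j : ℕ) : 0 < width j := zpow_pos two_pos _

theorem thick_pos (n j : ℕ) : 0 < thick n j := zpow_pos two_pos _

theorem delta1_pos (n j : ℕ) : 0 < delta1 n j := div_pos (thick_pos n j) four_pos

theorem delta2_pos (n j : ℕ) : 0 < delta2 n j :=
  div_pos (thick_pos n j) (mul_pos four_pos (width_pos j))

theorem delta2_mul_width (n j : ℕ) : delta2 n j * width j = delta1 n j := by
  have := (width_pos j).ne'
  rw [delta1, delta2]; field

theorem width_eq (j : ℕ) : width j = ((2 : ℝ) ^ j)⁻¹ := by rw [width, zpow_neg, zpow_natCast]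

theorem inv_width (j : ℕ) : (width j)⁻¹ = 2 ^ j := by rw [width_eq, inv_inv]

/-- The area does not depend on the scale, and lies between 1/n and 2/n as `n ≤ 2 ^ J ≤ 2 * n`. The
upper bound gives Poisson(2) under the null, the lower one the choice of scale. -/
theorem width_mul_thick (n j : ℕ) : width j * thick n j = 2 / 2 ^ dyadicLog n := by
  rw [width, thick, ← zpow_add₀ two_ne_zero,
    show -(j : ℤ) + (-((dyadicLog n : ℤ) - j) + 1) = 1 - dyadicLog n by ring,
    zpow_sub₀ two_ne_zero, zpow_one, zpow_natCast]

theorem inv_delta1 {n j : ℕ} (hj : j ≤ dyadicLog n) :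
    (delta1 n j)⁻¹ = ((2 ^ (dyadicLog n + 1 - j) : ℕ) : ℝ) := by
  have h2 : ((dyadicLog n + 1 - j : ℕ) : ℤ) = dyadicLog n + 1 - j := by
    rw [Nat.cast_sub (by omega)]; push_cast; ring
  rw [delta1, inv_div, thick]
  push_cast
  rw [← zpow_natCast, h2, show ((dyadicLog n : ℤ) + 1 - j) = 2 - (-((dyadicLog n : ℤ) - j) + 1) by
    ring, zpow_sub₀ two_ne_zero]
  norm_num

theorem inv_delta2_le (n j : ℕ) : (delta2 n j)⁻¹ ≤ 2 ^ (dyadicLog n + 1) := by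
  have h1 := width_mul_thick n j
  have h2 : (delta2 n j)⁻¹ = 4 * width j ^ 2 / (width j * thick n j) := by
    have := (width_pos j).ne'
    have := (thick_pos n j).ne'
    rw [delta2]; field
  have h3 : width j ≤ 1 := by
    rw [width_eq]
    exact inv_le_one_of_one_le₀ (one_le_pow₀ one_le_two)
  rw [h2, h1, pow_succ 2, div_div_eq_mul_div]
  have h4 : width j ^ 2 ≤ 1 := pow_le_one₀ (width_pos j).le h3
  have h5 : (0 : ℝ) < 2 ^ dyadicLog n := by positivity
  nlinarith

theorem le_two_pow_dyadicLog (n : ℕ) : n ≤ 2 ^ dyadicLog n := Nat.le_pow_clog one_lt_two n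

theorem two_pow_dyadicLog_le {n : ℕ} (hn : 1 ≤ n) : 2 ^ dyadicLog n ≤ 2 * n := by
  rcases hn.eq_or_lt with rfl | hn
  · simp [dyadicLog]
  · have h1 := Nat.pow_pred_clog_lt_self one_lt_two hn
    have h2 : 0 < Nat.clog 2 n := Nat.clog_pos one_lt_two hn
    have h3 : 2 ^ dyadicLog n = 2 * 2 ^ (Nat.clog 2 n).pred := by
      rw [← pow_succ', ← Nat.succ_eq_add_one, Nat.succ_pred_eq_of_pos h2, dyadicLog]
    omega

theorem measurableSet_strip (n j : ℕ) (v : StripIndex) : MeasurableSet (strip n j v) := by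
  have h : Measurable fun p : ℝ × ℝ => |p.2 - ((v.l1 : ℝ) * delta1 n j
      + (v.l2 : ℝ) * delta2 n j * (p.1 - ((v.k : ℝ) + 1 / 2) * width j))| := by fun_prop
  exact (measurableSet_le measurable_const measurable_fst).inter
    ((measurableSet_lt measurable_fst measurable_const).inter (measurableSet_le h measurable_const))

theorem disjoint_strip {n j : ℕ} {v v' : StripIndex} (h : v.k ≠ v'.k) :
    Disjoint (strip n j v) (strip n j v') := by
  rw [Set.disjoint_left]
  rintro p ⟨h1, h2, -⟩ ⟨h3, h4, -⟩
  have hw := width_pos j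
  have h5 : (v.k : ℝ) < v'.k + 1 := lt_of_mul_lt_mul_right (h1.trans_lt h4) hw.le
  have h6 : (v'.k : ℝ) < v.k + 1 := lt_of_mul_lt_mul_right (h3.trans_lt h2) hw.le
  norm_cast at h5 h6
  omega

instance isProbabilityMeasure_unifSquare : IsProbabilityMeasure unifSquare :=
  ⟨by rw [unifSquare, Measure.restrict_apply_univ, Measure.volume_eq_prod, Measure.prod_prod]; simp⟩

theorem volume_strip_le (n j : ℕ) (v : StripIndex) :
    volume (strip n j v) ≤ ENNReal.ofReal (width j * thick n j) := by
  rw [Measure.volume_eq_prod, Measure.prod_apply (measurableSet_strip n j v)]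
  have hle : ∀ x : ℝ, volume (Prod.mk x ⁻¹' strip n j v) ≤
      (Ico ((v.k : ℝ) * width j) (((v.k : ℝ) + 1) * width j)).indicator
        (fun _ => ENNReal.ofReal (thick n j)) x := by
    intro x
    by_cases hx : x ∈ Ico ((v.k : ℝ) * width j) (((v.k : ℝ) + 1) * width j)
    · rw [indicator_of_mem hx]
      set m := (v.l1 : ℝ) * delta1 n j
        + (v.l2 : ℝ) * delta2 n j * (x - ((v.k : ℝ) + 1 / 2) * width j)
      calc volume (Prod.mk x ⁻¹' strip n j v)
          ≤ volume (Icc (m - thick n j / 2) (m + thick n j / 2)) :=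
            measure_mono fun y hy => by
              have h : |y - m| ≤ thick n j / 2 := hy.2.2
              rw [abs_le] at h
              exact ⟨by linarith [h.1], by linarith [h.2]⟩
        _ = _ := by rw [Real.volume_Icc]; congr 1; ring
    · rw [indicator_of_notMem hx]
      refine (measure_mono_null (t := ∅) (fun y hy => hx ⟨hy.1, hy.2.1⟩) (by simp)).le
  refine (lintegral_mono hle).trans ?_
  rw [lintegral_indicator_const measurableSet_Ico, Real.volume_Ico,
    ← ENNReal.ofReal_mul (thick_pos n j).le]
  refine ENNReal.ofReal_le_ofReal (le_of_eq ?_)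
  ring

theorem unifSquare_real_strip_le {n : ℕ} (hn : 1 ≤ n) (j : ℕ) (v : StripIndex) :
    unifSquare.real (strip n j v) ≤ 2 / n := by
  refine ENNReal.toReal_le_of_le_ofReal (by positivity) ?_
  refine (Measure.restrict_apply_le _ _).trans ((volume_strip_le n j v).trans
    (ENNReal.ofReal_le_ofReal ?_))
  rw [width_mul_thick]
  have : (n : ℝ) ≤ 2 ^ dyadicLog n := by exact_mod_cast le_two_pow_dyadicLog n
  have : (0 : ℝ) < n := by exact_mod_cast hn
  gcongr

/-! ### Significance of a given path under uniformity -/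

/-- Negative association for blocks of a single cell (indexed by `Unit`), then monotonicity in the
cell probability. -/
theorem sampleLaw_forall_lt_count_le {m : ℕ} (P : Measure (ℝ × ℝ)) [IsProbabilityMeasure P]
    {A : Fin m → Set (ℝ × ℝ)} (hA : ∀ i, MeasurableSet (A i))
    (hd : Pairwise (Function.onFun Disjoint A)) {q : ℝ} (hq1 : q ≤ 1) (hq : ∀ i, P.real (A i) ≤ q)
    (N n : ℕ) : sampleLaw n P {x | ∀ i, N < count x (A i)}
      ≤ ENNReal.ofReal (binTail q N n 0 ^ m) := by
  let A' : Fin m × Unit → Set (ℝ × ℝ) := fun i => A i.1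
  have hA' : ∀ i, MeasurableSet (A' i) := fun i => hA i.1
  have hd' : Pairwise (Function.onFun Disjoint A') := fun i i' h =>
    hd fun h' => h (Prod.ext h' (Subsingleton.elim _ _))
  let Φ : Set (Fin m × Unit → ℕ) := {c | ∀ i, N < c (i, ())}
  have h1 := sampleLaw_count_mem P hA' hd' Φ n 0
  have h2 : {x : Fin n → ℝ × ℝ | (fun i => (0 : Fin m × Unit → ℕ) i + count x (A' i)) ∈ Φ}
      = {x | ∀ i, N < count x (A i)} := by
    ext x; simp [Φ, A']
  have h3 : Φ.indicator (1 : (Fin m × Unit → ℕ) → ℝ)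
      = fun c => ∏ i : Fin m, (fun c : Unit → ℕ => if N < c () then (1 : ℝ) else 0)
        fun u => c (i, u) := by
    ext c
    rw [Finset.prod_boole]
    simp [Set.indicator_apply, Φ]
  rw [h2] at h1
  rw [h1, h3]
  refine ENNReal.ofReal_le_ofReal ((occupancy_prod_le (fun i => measureReal_nonneg)
    (sum_measureReal_le_one P hA' hd') (φ := fun (_ : Fin m) c => if N < c () then (1 : ℝ) else 0)
    (fun b c => by positivity) (.inl fun _ => monotone_ite_lt N ()) n 0).trans ?_)
  rw [← Fin.prod_const]
  refine Finset.prod_le_prod (fun i _ => occupancy_nonneg (fun _ => measureReal_nonneg)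
    (by simp) (fun c => by positivity) _ _) fun i _ => ?_
  exact occupancy_mono_prob (fun _ => measureReal_nonneg) (fun _ => hq i) (by simpa using hq1)
    (monotone_ite_lt N ()) n _

theorem pairwise_k_lt {π : List StripIndex} (h : π.IsChain GoodContinuation) :
    π.Pairwise fun a b => a.k < b.k := by
  have : π.IsChain fun a b => a.k < b.k := h.imp fun a b hab => by have := hab.1; omega
  have : IsTrans StripIndex fun a b => a.k < b.k := ⟨fun _ _ _ => lt_trans⟩
  rwa [← List.isChain_iff_pairwise]

/-- Every edge advances one column, so the strips of a path are pairwise disjoint. -/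
theorem sampleLaw_significant_le {n : ℕ} (hn : 2 ≤ n) (N j : ℕ) {π : List StripIndex}
    (h : π.IsChain GoodContinuation) :
    sampleLaw n unifSquare {x | ∀ v ∈ π, N < count x (strip n j v)}
      ≤ ENNReal.ofReal (binTail (2 / n) N n 0 ^ π.length) := by
  have hp := pairwise_k_lt h
  have hne : ∀ a b : Fin π.length, a < b → (π.get a).k < (π.get b).k :=
    fun a b hab => List.pairwise_iff_get.1 hp a b hab
  have h1 := sampleLaw_forall_lt_count_le unifSquare (A := fun i => strip n j (π.get i))
    (fun i => measurableSet_strip n j _)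
    (fun a b hab => disjoint_strip (by
      rcases lt_or_gt_of_ne hab with h | h
      · exact (hne a b h).ne
      · exact (hne b a h).ne')) (q := 2 / n)
    (div_le_one_of_le₀ (by exact_mod_cast hn) (by positivity))
    (fun i => unifSquare_real_strip_le (by omega) j _) N n
  refine (measure_mono fun x hx => ?_).trans h1
  exact fun i => hx _ (List.get_mem π i)

/-! ### Enumeration of the paths -/

open Classical in
/-- The out-neighbours of a strip. -/
noncomputable def continuations (a : StripIndex) : Finset StripIndex :=
  (Finset.Icc (-4 : ℤ) 4 ×ˢ Finset.Icc (-4 : ℤ) 4).image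
    fun p => ⟨a.k + 1, a.l1 + a.l2 + p.1, a.l2 + p.2⟩

theorem GoodContinuation.mem_continuations {a b : StripIndex} (h : GoodContinuation a b) :
    b ∈ continuations a := by
  classical
  obtain ⟨h1, h2, h3⟩ := h
  rw [abs_le] at h2 h3
  refine Finset.mem_image.2 ⟨(b.l1 - (a.l1 + a.l2), b.l2 - a.l2), ?_, ?_⟩
  · simp only [Finset.mem_product, Finset.mem_Icc]; omega
  · cases b; simp_all

theorem card_continuations_le (a : StripIndex) : (continuations a).card ≤ 81 := by
  classical
  exact Finset.card_image_le.trans (by simp)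

open Classical in
/-- The paths with `m` edges starting at a given strip. -/
noncomputable def pathsFrom : ℕ → StripIndex → Finset (List StripIndex)
  | 0, a => {[a]}
  | m + 1, a => (continuations a).biUnion fun b => (pathsFrom m b).image (List.cons a)

theorem card_pathsFrom_le (m : ℕ) (a : StripIndex) : (pathsFrom m a).card ≤ 81 ^ m := by
  classical
  induction m generalizing a with
  | zero => simp [pathsFrom]
  | succ m ih =>
    refine (Finset.card_biUnion_le_card_mul _ _ (81 ^ m) fun b _ =>
      Finset.card_image_le.trans (ih b)).trans ?_
    rw [pow_succ']
    exact Nat.mul_le_mul_right _ (card_continuations_le a)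

theorem mem_pathsFrom {m : ℕ} {a : StripIndex} {l : List StripIndex} (hl : l.length = m)
    (h : (a :: l).IsChain GoodContinuation) : a :: l ∈ pathsFrom m a := by
  classical
  induction m generalizing a l with
  | zero =>
    rw [List.length_eq_zero_iff] at hl
    simp [pathsFrom, hl]
  | succ m ih =>
    cases l with
    | nil => simp at hl
    | cons b l =>
    rw [List.isChain_cons_cons] at h
    simp only [pathsFrom, Finset.mem_biUnion, Finset.mem_image]
    exact ⟨b, h.1.mem_continuations, b :: l, ih (by simpa using hl) h.2, rfl⟩

open Classical in
/-- A finite set containing the vertices of the graph of scale `j`. -/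
noncomputable def vertexBox (S : ℝ) (n j : ℕ) : Finset StripIndex :=
  (Finset.range (2 ^ j) ×ˢ Finset.range (2 ^ (dyadicLog n + 1 - j)) ×ˢ
    Finset.Icc (-(⌊S * (delta2 n j)⁻¹⌋₊ : ℤ)) ⌊S * (delta2 n j)⁻¹⌋₊).image
    fun p => ⟨p.1, p.2.1, p.2.2⟩

theorem IsVertex.mem_vertexBox {S : ℝ} {n j : ℕ} (hj : j ≤ dyadicLog n) {v : StripIndex}
    (h : IsVertex S n j v) : v ∈ vertexBox S n j := by
  classical
  obtain ⟨h1, h2, h3, h4⟩ := h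
  rw [inv_width] at h1
  rw [inv_delta1 hj] at h3
  have hk : v.k < 2 ^ j := by exact_mod_cast h1
  have hl1 : v.l1.toNat < 2 ^ (dyadicLog n + 1 - j) := by
    have h5 : (v.l1 : ℝ) + 1 ≤ ((2 ^ (dyadicLog n + 1 - j) : ℕ) : ℝ) := by linarith
    have h6 : v.l1 + 1 ≤ ((2 ^ (dyadicLog n + 1 - j) : ℕ) : ℤ) := by exact_mod_cast h5
    generalize 2 ^ (dyadicLog n + 1 - j) = M at h6 ⊢
    omega
  have hl2 : |v.l2| ≤ (⌊S * (delta2 n j)⁻¹⌋₊ : ℤ) := by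
    rw [Int.abs_eq_natAbs, Nat.cast_le]
    refine Nat.le_floor (le_trans (le_of_eq ?_) h4)
    rw [Nat.cast_natAbs, Int.cast_abs]
  have hv : v = ⟨v.k, (v.l1.toNat : ℤ), v.l2⟩ := by rw [Int.toNat_of_nonneg h2]
  rw [hv]
  exact Finset.mem_image_of_mem (fun p : ℕ × ℕ × ℤ => (⟨p.1, p.2.1, p.2.2⟩ : StripIndex))
    (a := (v.k, v.l1.toNat, v.l2)) (Finset.mem_product.2 ⟨Finset.mem_range.2 hk,
      Finset.mem_product.2 ⟨Finset.mem_range.2 hl1, Finset.mem_Icc.2 (abs_le.1 hl2)⟩⟩)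

/-- Columns and heights together number `2 ^ (J + 1) ≤ 4 * n` at every scale, and there are at most
`8 * S * n + 1` slopes. -/
theorem card_vertexBox_le {S : ℝ} (hS : 1 ≤ S) {n j : ℕ} (hn : 1 ≤ n) (hj : j ≤ dyadicLog n) :
    ((vertexBox S n j).card : ℝ) ≤ 36 * S * n ^ 2 := by
  classical
  have h1 : (vertexBox S n j).card
      ≤ 2 ^ (dyadicLog n + 1) * (2 * ⌊S * (delta2 n j)⁻¹⌋₊ + 1) := by
    refine Finset.card_image_le.trans ?_
    rw [Finset.card_product, Finset.card_product, Finset.card_range, Finset.card_range,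
      Int.card_Icc, ← mul_assoc, ← pow_add, show j + (dyadicLog n + 1 - j) = dyadicLog n + 1 by omega]
    exact Nat.mul_le_mul_left _ (by omega)
  have h2 : (2 : ℝ) ^ (dyadicLog n + 1) ≤ 4 * n := by
    have : (2 : ℝ) ^ dyadicLog n ≤ 2 * n := by exact_mod_cast two_pow_dyadicLog_le hn
    rw [pow_succ]; linarith
  have h3 : (⌊S * (delta2 n j)⁻¹⌋₊ : ℝ) ≤ S * (4 * n) :=
    (Nat.floor_le (mul_nonneg (by linarith) (inv_nonneg.2 (delta2_pos n j).le))).trans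
      (mul_le_mul_of_nonneg_left ((inv_delta2_le n j).trans h2) (by linarith))
  have h4 : (1 : ℝ) ≤ n := by exact_mod_cast hn
  calc ((vertexBox S n j).card : ℝ)
      ≤ 2 ^ (dyadicLog n + 1) * (2 * ⌊S * (delta2 n j)⁻¹⌋₊ + 1) := by exact_mod_cast h1
    _ ≤ (4 * n) * (2 * (S * (4 * n)) + 1) := by gcongr
    _ ≤ 36 * S * n ^ 2 := by nlinarith [mul_le_mul hS h4 zero_le_one (by linarith)]

/-! ### The null hypothesis -/

theorem rejects_subset (S : ℝ) (N : ℕ) {L : ℝ} (hL : 0 ≤ L) (n : ℕ) :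
    rejects S N L n ⊆ ⋃ j ∈ Finset.range (dyadicLog n + 1), ⋃ v ∈ vertexBox S n j,
      ⋃ π ∈ pathsFrom ⌊L⌋₊ v, {x | (π.IsChain GoodContinuation ∧ π.length = ⌊L⌋₊ + 1) ∧
        ∀ v ∈ π, N < count x (strip n j v)} := by
  intro x hx
  obtain ⟨j, hj, π, hπ, hlt⟩ := lt_longestRun_iff.1 ((Nat.floor_lt hL).2 hx)
  -- Truncating a long path to its first `⌊L⌋₊ + 1` strips leaves only one length in the union
  -- bound.
  have hlen : (π.take (⌊L⌋₊ + 1)).length = ⌊L⌋₊ + 1 := by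
    rw [List.length_take]; omega
  obtain ⟨v, l, hvl⟩ := List.exists_cons_of_length_eq_add_one hlen
  have hchain := hπ.connected.take (⌊L⌋₊ + 1)
  have hmem : ∀ w ∈ v :: l, w ∈ π := fun w hw => List.mem_of_mem_take (hvl ▸ hw)
  rw [hvl] at hlen hchain
  simp only [mem_iUnion, exists_prop]
  exact ⟨j, by simp; omega, v, (hπ.vertex v (hmem v (by simp))).mem_vertexBox hj, v :: l,
    mem_pathsFrom (by simpa using hlen) hchain, ⟨hchain, hlen⟩,
    fun w hw => hπ.significant w (hmem w hw)⟩

theorem sampleLaw_unifSquare_rejects_le {S : ℝ} (hS : 1 ≤ S) (N : ℕ) {L : ℝ} (hL : 0 ≤ L) {n : ℕ}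
    (hn : 2 ≤ n) {p₀ : ℝ} (hp0 : 0 ≤ p₀) (hb : binTail (2 / n) N n 0 ≤ p₀ / 81) :
    sampleLaw n unifSquare (rejects S N L n)
      ≤ ENNReal.ofReal ((dyadicLog n + 1) * (36 * S * n ^ 2) * p₀ ^ (⌊L⌋₊ + 1)) := by
  set m := ⌊L⌋₊
  have hb0 : 0 ≤ binTail (2 / n) N n 0 := binTail_nonneg (by positivity)
    (div_le_one_of_le₀ (by exact_mod_cast hn) (by positivity)) N n 0
  have hpath : ∀ j, ∀ π : List StripIndex, sampleLaw n unifSquare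
      {x | (π.IsChain GoodContinuation ∧ π.length = m + 1) ∧
        ∀ v ∈ π, N < count x (strip n j v)} ≤ ENNReal.ofReal ((p₀ / 81) ^ (m + 1)) := by
    intro j π
    by_cases h : π.IsChain GoodContinuation ∧ π.length = m + 1
    · simp only [h, true_and]
      refine (sampleLaw_significant_le hn N j h.1).trans (ENNReal.ofReal_le_ofReal ?_)
      rw [h.2]
      gcongr
    · simp [h]
  calc sampleLaw n unifSquare (rejects S N L n)
      ≤ ∑ j ∈ Finset.range (dyadicLog n + 1), ∑ v ∈ vertexBox S n j, ∑ π ∈ pathsFrom m v,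
          ENNReal.ofReal ((p₀ / 81) ^ (m + 1)) := by
        refine (measure_mono (rejects_subset S N hL n)).trans
          ((measure_biUnion_finset_le _ _).trans (Finset.sum_le_sum fun j _ => ?_))
        refine (measure_biUnion_finset_le _ _).trans (Finset.sum_le_sum fun v _ => ?_)
        exact (measure_biUnion_finset_le _ _).trans (Finset.sum_le_sum fun π _ => hpath j π)
    _ = ENNReal.ofReal (∑ j ∈ Finset.range (dyadicLog n + 1), ∑ v ∈ vertexBox S n j,
          ∑ π ∈ pathsFrom m v, (p₀ / 81) ^ (m + 1)) := by
        have h0 : (0 : ℝ) ≤ (p₀ / 81) ^ (m + 1) := by positivity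
        rw [ENNReal.ofReal_sum_of_nonneg fun j _ =>
          Finset.sum_nonneg fun v _ => Finset.sum_nonneg fun π _ => h0]
        refine Finset.sum_congr rfl fun j _ => ?_
        rw [ENNReal.ofReal_sum_of_nonneg fun v _ => Finset.sum_nonneg fun π _ => h0]
        exact Finset.sum_congr rfl fun v _ => (ENNReal.ofReal_sum_of_nonneg fun π _ => h0).symm
    _ ≤ _ := by
        refine ENNReal.ofReal_le_ofReal ?_
        calc _ ≤ ∑ j ∈ Finset.range (dyadicLog n + 1), ∑ v ∈ vertexBox S n j, p₀ ^ (m + 1) := by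
              refine Finset.sum_le_sum fun j _ => Finset.sum_le_sum fun v _ => ?_
              rw [Finset.sum_const, nsmul_eq_mul]
              -- One factor 81 is wasted so that the path count cancels the denominator of `(p₀ /
              -- 81) ^ (m + 1)`.
              have h1 : ((pathsFrom m v).card : ℝ) ≤ 81 ^ (m + 1) :=
                (show ((pathsFrom m v).card : ℝ) ≤ 81 ^ m by
                  exact_mod_cast card_pathsFrom_le m v).trans
                  (pow_le_pow_right₀ (by norm_num) (by omega))
              calc _ ≤ (81 : ℝ) ^ (m + 1) * (p₀ / 81) ^ (m + 1) := by gcongr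
                _ = _ := by rw [← mul_pow]; congr 1; ring
          _ ≤ ∑ j ∈ Finset.range (dyadicLog n + 1), 36 * S * n ^ 2 * p₀ ^ (m + 1) := by
              refine Finset.sum_le_sum fun j hj => ?_
              rw [Finset.sum_const, nsmul_eq_mul]
              exact mul_le_mul_of_nonneg_right (card_vertexBox_le hS (by omega)
                (by simpa [Nat.lt_succ_iff] using hj)) (by positivity)
          _ = _ := by rw [Finset.sum_const, nsmul_eq_mul]; simp; ring

/-- Used with `a = 1` under the null (n⁻³ against n² strips) and with `a = 1/36` for the power. -/
theorem rpow_runThreshold {p₀ : ℝ} (hp₀ : p₀ ∈ Ioo (0 : ℝ) 1) (a : ℝ) {n : ℕ} (hn : 1 ≤ n) :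
    p₀ ^ (a * runThreshold p₀ n) = (n : ℝ) ^ (-3 * a) := by
  have h1 : Real.log p₀ ≠ 0 := (Real.log_neg hp₀.1 hp₀.2).ne
  have h2 : (0 : ℝ) < n := by exact_mod_cast hn
  rw [Real.rpow_def_of_pos hp₀.1, Real.rpow_def_of_pos h2, runThreshold, Real.logb, one_div,
    Real.log_inv]
  congr 1
  field

theorem runThreshold_nonneg {p₀ : ℝ} (hp₀ : p₀ ∈ Ioo (0 : ℝ) 1) {n : ℕ} (hn : 1 ≤ n) :
    0 ≤ runThreshold p₀ n :=
  mul_nonneg (by norm_num) (Real.logb_nonneg ((one_lt_div hp₀.1).2 hp₀.2) (by exact_mod_cast hn))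

theorem tendsto_dyadicLog_div : Tendsto (fun n : ℕ => ((dyadicLog n : ℝ) + 1) / n) atTop (𝓝 0) := by
  have h1 : Tendsto (fun n : ℕ => Real.log n / (n : ℝ)) atTop (𝓝 0) :=
    (Real.isLittleO_log_id_atTop.tendsto_div_nhds_zero).comp tendsto_natCast_atTop_atTop
  have h2 : Tendsto (fun n : ℕ => (n : ℝ)⁻¹) atTop (𝓝 0) := tendsto_inv_atTop_nhds_zero_nat
  have h3 : Tendsto (fun n : ℕ => Real.log n / (n : ℝ) * (Real.log 2)⁻¹ + 2 * (n : ℝ)⁻¹) atTop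
      (𝓝 0) := by
    simpa using (h1.mul_const (Real.log 2)⁻¹).add (h2.const_mul 2)
  refine squeeze_zero' (.of_forall fun n => by positivity) ?_ h3
  filter_upwards [eventually_ge_atTop 1] with n hn
  have h4 : (0 : ℝ) < n := by exact_mod_cast hn
  have h5 : (dyadicLog n : ℝ) ≤ Real.log n / Real.log 2 + 1 := by
    have : (2 : ℝ) ^ dyadicLog n ≤ 2 * n := by exact_mod_cast two_pow_dyadicLog_le hn
    have h6 := Real.log_le_log (by positivity) this
    rw [Real.log_pow, Real.log_mul two_ne_zero h4.ne'] at h6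
    have h7 : 0 < Real.log 2 := Real.log_pos one_lt_two
    rw [div_add_one h7.ne', le_div_iff₀ h7]
    linarith
  calc ((dyadicLog n : ℝ) + 1) / n ≤ (Real.log n / Real.log 2 + 1 + 1) / n := by gcongr
    _ = _ := by ring

theorem tendsto_sampleLaw_unifSquare_rejects {S : ℝ} (hS : 1 ≤ S) {p₀ : ℝ}
    (hp₀ : p₀ ∈ Ioo (0 : ℝ) 1) {N : ℕ} (hN : IsCountThreshold p₀ N) :
    Tendsto (fun n : ℕ => sampleLaw n unifSquare (rejects S N (runThreshold p₀ n) n))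
      atTop (𝓝 0) := by
  have h1 : Tendsto (fun n : ℕ => ENNReal.ofReal (36 * S * (((dyadicLog n : ℝ) + 1) / n))) atTop
      (𝓝 0) := by
    simpa using ENNReal.tendsto_ofReal (tendsto_dyadicLog_div.const_mul (36 * S))
  refine tendsto_of_tendsto_of_tendsto_of_le_of_le' tendsto_const_nhds h1
    (.of_forall fun n => bot_le) ?_
  filter_upwards [hN.eventually_binTail_le hp₀.1, eventually_ge_atTop 2] with n hb hn
  have hL := runThreshold_nonneg hp₀ (show 1 ≤ n by omega)
  refine (sampleLaw_unifSquare_rejects_le hS N hL hn hp₀.1.le hb).trans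
    (ENNReal.ofReal_le_ofReal ?_)
  have h2 : (0 : ℝ) < n := by exact_mod_cast (show 0 < n by omega)
  have h3 : p₀ ^ (⌊runThreshold p₀ n⌋₊ + 1) ≤ ((n : ℝ) ^ 3)⁻¹ := by
    have h4 := rpow_runThreshold hp₀ 1 (show 1 ≤ n by omega)
    rw [one_mul, mul_one, Real.rpow_neg h2.le] at h4
    rw [← Real.rpow_natCast]
    refine (Real.rpow_le_rpow_of_exponent_ge hp₀.1 hp₀.2.le ?_).trans (h4.le.trans ?_)
    · push_cast; exact (Nat.lt_floor_add_one _).le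
    · norm_cast
  calc _ ≤ (dyadicLog n + 1) * (36 * S * n ^ 2) * ((n : ℝ) ^ 3)⁻¹ := by
        have : 0 ≤ S := by linarith
        gcongr
    _ = _ := by field

/-! ### Arc length and the contaminated distribution -/

section ArcLength

variable {α β S : ℝ} {f : ℝ → ℝ} (hf : HolderClass α β S f)

include hf

/-- `f` is arbitrary off `[0,1]`, so `x ↦ (x, f x)` is only a.e. measurable, for the restricted
measure. -/
theorem HolderClass.arcLength_apply {R : Set (ℝ × ℝ)} (hR : MeasurableSet R) :
    arcLength f R = ((volume.restrict (Icc (0 : ℝ) 1)).withDensity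
      fun x => ENNReal.ofReal (Real.sqrt (1 + derivWithin f (Icc 0 1) x ^ 2)))
        ((fun x => (x, f x)) ⁻¹' R) := by
  rw [arcLength, Measure.map_apply_of_aemeasurable _ hR]
  have h1 : AEMeasurable f (volume.restrict (Icc (0 : ℝ) 1)) :=
    hf.differentiableOn.continuousOn.aemeasurable measurableSet_Icc
  exact (aemeasurable_id.prodMk h1).mono_ac (withDensity_absolutelyContinuous _ _)

theorem HolderClass.arcLength_univ_le :
    arcLength f univ ≤ ENNReal.ofReal (Real.sqrt (1 + S ^ 2)) := by
  rw [hf.arcLength_apply MeasurableSet.univ, preimage_univ, withDensity_apply _ .univ,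
    Measure.restrict_univ]
  calc _ ≤ ∫⁻ _ in Icc (0 : ℝ) 1, ENNReal.ofReal (Real.sqrt (1 + S ^ 2)) := by
        refine setLIntegral_mono' measurableSet_Icc fun x hx => ENNReal.ofReal_le_ofReal
          (Real.sqrt_le_sqrt ?_)
        have := sq_le_sq' (neg_le_of_abs_le (hf.slope x hx)) (le_of_abs_le (hf.slope x hx))
        linarith
    _ = _ := by simp

/-- The arc length density is at least 1. -/
theorem HolderClass.le_arcLength {R : Set (ℝ × ℝ)} (hR : MeasurableSet R) {a b : ℝ} (ha : 0 ≤ a)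
    (hb : b ≤ 1) (h : ∀ x ∈ Ico a b, (x, f x) ∈ R) :
    ENNReal.ofReal (b - a) ≤ arcLength f R := by
  rw [hf.arcLength_apply hR]
  calc ENNReal.ofReal (b - a) = volume.restrict (Icc (0 : ℝ) 1) (Ico a b) := by
        rw [Measure.restrict_apply measurableSet_Ico, inter_eq_left.2, Real.volume_Ico]
        exact fun x hx => ⟨ha.trans hx.1, hx.2.le.trans hb⟩
    _ ≤ volume.restrict (Icc (0 : ℝ) 1) ((fun x => (x, f x)) ⁻¹' R) := measure_mono h
    _ ≤ _ := by
        refine Measure.le_iff'.1 ?_ _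
        conv_lhs => rw [← withDensity_one (μ := volume.restrict (Icc (0 : ℝ) 1))]
        refine withDensity_mono (.of_forall fun x => ?_)
        rw [Pi.one_apply, ← ENNReal.ofReal_one]
        exact ENNReal.ofReal_le_ofReal
          (Real.one_le_sqrt.2 (le_add_of_nonneg_right (sq_nonneg _)))

theorem HolderClass.arcLength_univ_ne_zero : arcLength f univ ≠ 0 := by
  have := hf.le_arcLength (R := univ) .univ le_rfl le_rfl fun _ _ => trivial
  intro h
  simp [h] at this

theorem HolderClass.isProbabilityMeasure_unifGraph : IsProbabilityMeasure (unifGraph f) :=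
  ⟨by
    rw [unifGraph, Measure.smul_apply, smul_eq_mul]
    exact ENNReal.inv_mul_cancel hf.arcLength_univ_ne_zero
      (hf.arcLength_univ_le.trans_lt ENNReal.ofReal_lt_top).ne⟩

theorem HolderClass.le_unifGraph {R : Set (ℝ × ℝ)} (hR : MeasurableSet R) {a b : ℝ} (ha : 0 ≤ a)
    (hb : b ≤ 1) (h : ∀ x ∈ Ico a b, (x, f x) ∈ R) :
    ENNReal.ofReal ((b - a) / Real.sqrt (1 + S ^ 2)) ≤ unifGraph f R := by
  have h0 : 0 < Real.sqrt (1 + S ^ 2) := Real.sqrt_pos.2 (by positivity)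
  rw [unifGraph, Measure.smul_apply, smul_eq_mul, div_eq_inv_mul,
    ENNReal.ofReal_mul (inv_nonneg.2 h0.le), ENNReal.ofReal_inv_of_pos h0]
  exact mul_le_mul' (ENNReal.inv_le_inv.2 hf.arcLength_univ_le) (hf.le_arcLength hR ha hb h)

variable {ε : ℝ} (hε0 : 0 ≤ ε) (hε1 : ε ≤ 1)

include hε0 hε1

theorem HolderClass.isProbabilityMeasure_mixture : IsProbabilityMeasure (mixture ε f) := by
  have := hf.isProbabilityMeasure_unifGraph
  refine ⟨?_⟩
  simp only [mixture, Measure.add_apply, Measure.smul_apply, measure_univ, smul_eq_mul, mul_one]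
  rw [← ENNReal.ofReal_add (by linarith) hε0, sub_add_cancel, ENNReal.ofReal_one]

theorem HolderClass.le_mixture {R : Set (ℝ × ℝ)} (hR : MeasurableSet R) {a b : ℝ} (ha : 0 ≤ a)
    (hb : b ≤ 1) (h : ∀ x ∈ Ico a b, (x, f x) ∈ R) :
    ε * ((b - a) / Real.sqrt (1 + S ^ 2)) ≤ (mixture ε f).real R := by
  have := hf.isProbabilityMeasure_mixture hε0 hε1
  rw [measureReal_def, ← ENNReal.ofReal_le_iff_le_toReal (measure_ne_top _ _),
    ENNReal.ofReal_mul hε0]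
  simp only [mixture, Measure.add_apply, Measure.smul_apply, smul_eq_mul]
  exact (mul_le_mul_right (hf.le_unifGraph hR ha hb h) _).trans le_add_self

end ArcLength

/-! ### Strips following a graph -/

/-- Mean value inequality for `z ↦ f z - f'(x) z` between `x` and `y`; the resulting constant `α *
β` is at most `2 * β`. -/
theorem HolderClass.abs_sub_sub_le {α β S : ℝ} {f : ℝ → ℝ} (hf : HolderClass α β S f)
    (hα : α ∈ Ioc (1 : ℝ) 2) (hβ : 0 < β) {x y : ℝ} (hx : x ∈ Icc (0 : ℝ) 1)
    (hy : y ∈ Icc (0 : ℝ) 1) :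
    |f y - f x - derivWithin f (Icc 0 1) x * (y - x)| ≤ 2 * β * |y - x| ^ α := by
  set g := derivWithin f (Icc 0 1)
  have hsub : uIcc x y ⊆ Icc 0 1 := uIcc_subset_Icc hx hy
  have h1 : ∀ z ∈ uIcc x y,
      HasDerivWithinAt (fun z => f z - g x * z) (g z - g x) (uIcc x y) z := by
    intro z hz
    have h2 := ((hf.differentiableOn z (hsub hz)).hasDerivWithinAt.mono hsub).sub
      ((hasDerivWithinAt_id z (uIcc x y)).const_mul (g x))
    rw [mul_one] at h2
    exact h2
  have h2 : ∀ z ∈ uIcc x y, ‖g z - g x‖ ≤ α * β * |y - x| ^ (α - 1) := by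
    intro z hz
    refine (hf.holder z (hsub hz) x hx).trans ?_
    have h3 : |z - x| ≤ |y - x| := abs_sub_left_of_mem_uIcc hz
    have h4 : 0 ≤ α * β := mul_nonneg (by linarith [hα.1]) hβ.le
    exact mul_le_mul_of_nonneg_left
      (Real.rpow_le_rpow (abs_nonneg _) h3 (by linarith [hα.1])) h4
  have h3 := (convex_uIcc x y).norm_image_sub_le_of_norm_hasDerivWithin_le h1 h2
    left_mem_uIcc right_mem_uIcc
  rw [Real.norm_eq_abs, Real.norm_eq_abs] at h3
  calc _ = |f y - g x * y - (f x - g x * x)| := by congr 1; ring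
    _ ≤ α * β * |y - x| ^ (α - 1) * |y - x| := h3
    _ = α * β * |y - x| ^ α := by
        rw [mul_assoc]
        congr 1
        rcases (abs_nonneg (y - x)).eq_or_lt with h | h
        · rw [← h, mul_zero, Real.zero_rpow (by linarith [hα.1])]
        · rw [← Real.rpow_add_one h.ne', sub_add_cancel]
    _ ≤ _ := by
        have := Real.rpow_nonneg (abs_nonneg (y - x)) α
        gcongr
        exact hα.2

/-- The abscissa of the middle of column `k` at scale `j`. -/
noncomputable def midpoint (j k : ℕ) : ℝ := ((k : ℝ) + 1 / 2) * width j

/-- The parameters of the strip `v` are discretizations of the value and the slope of `f` at the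
middle of its column. -/
structure Follows (f : ℝ → ℝ) (n j : ℕ) (v : StripIndex) : Prop where
  le_value : v.l1 * delta1 n j ≤ f (midpoint j v.k)
  value_le : f (midpoint j v.k) ≤ (v.l1 + 1) * delta1 n j
  slope : |v.l2 * delta2 n j - derivWithin f (Icc 0 1) (midpoint j v.k)| ≤ delta2 n j

/-- Rounding towards zero, so that a discretized slope still respects the bound `S`. -/
theorem exists_int_abs_le (r : ℝ) : ∃ l : ℤ, |(l : ℝ)| ≤ |r| ∧ |l - r| ≤ 1 := by
  rcases le_total 0 r with h | h
  · refine ⟨⌊r⌋, ?_, ?_⟩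
    · rw [abs_of_nonneg h, abs_of_nonneg (by exact_mod_cast Int.floor_nonneg.2 h)]
      exact Int.floor_le r
    · rw [abs_le]
      constructor <;> linarith [Int.floor_le r, Int.lt_floor_add_one r]
  · refine ⟨⌈r⌉, ?_, ?_⟩
    · have : (⌈r⌉ : ℝ) ≤ 0 := by exact_mod_cast Int.ceil_le.2 (by simpa using h)
      rw [abs_of_nonpos h, abs_of_nonpos this]
      linarith [Int.le_ceil r]
    · rw [abs_le]
      constructor <;> linarith [Int.le_ceil r, Int.ceil_lt_add_one r]

theorem exists_nat_mul_le {δ y : ℝ} (hδ : 0 < δ) {M : ℕ} (hM : δ⁻¹ = M) (hy : y ∈ Icc (0 : ℝ) 1) :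
    ∃ l : ℕ, (l : ℝ) ≤ δ⁻¹ - 1 ∧ l * δ ≤ y ∧ y ≤ (l + 1) * δ := by
  have hM0 : 0 < M := by
    have : (0 : ℝ) < M := hM ▸ inv_pos.2 hδ
    exact_mod_cast this
  have hMδ : (M : ℝ) * δ = 1 := by rw [← hM, inv_mul_cancel₀ hδ.ne']
  have h0 : 0 ≤ y / δ := div_nonneg hy.1 hδ.le
  rcases Nat.lt_or_ge ⌊y / δ⌋₊ M with h | h
  · refine ⟨⌊y / δ⌋₊, ?_, (le_div_iff₀ hδ).1 (Nat.floor_le h0),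
      (div_le_iff₀ hδ).1 (Nat.lt_floor_add_one _).le⟩
    rw [hM, le_sub_iff_add_le]
    exact_mod_cast h
  -- This happens only for `y = 1`, whose floor `M` is not admissible; the closed upper bound in the
  -- conclusion allows `M - 1`.
  · have h1 : ((M - 1 : ℕ) : ℝ) = M - 1 := by rw [Nat.cast_sub hM0, Nat.cast_one]
    refine ⟨M - 1, by rw [h1, hM], ?_, ?_⟩
    · rw [h1, sub_mul, hMδ]
      have h2 : (M : ℝ) ≤ y / δ := (Nat.cast_le.2 h).trans (Nat.floor_le h0)
      have h3 := (le_div_iff₀ hδ).1 h2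
      linarith
    · rw [h1, sub_add_cancel, hMδ]
      exact hy.2

theorem midpoint_mem {j k : ℕ} (hk : k < 2 ^ j) :
    0 ≤ (k : ℝ) * width j ∧ ((k : ℝ) + 1) * width j ≤ 1 ∧ midpoint j k ∈ Icc (0 : ℝ) 1 := by
  have hw := width_pos j
  have h1 : (k : ℝ) + 1 ≤ 2 ^ j := by exact_mod_cast hk
  have h2 : ((k : ℝ) + 1) * width j ≤ 1 := by
    rw [width_eq, ← div_eq_mul_inv]
    exact div_le_one_of_le₀ h1 (by positivity)
  have h3 : 0 ≤ (k : ℝ) * width j := by positivity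
  refine ⟨h3, h2, ?_, ?_⟩ <;> rw [midpoint] <;> linarith

section Follows

variable {α β S : ℝ} {f : ℝ → ℝ} (hf : HolderClass α β S f) {n j : ℕ}

include hf

theorem HolderClass.exists_follows (hj : j ≤ dyadicLog n) {k : ℕ} (hk : k < 2 ^ j) :
    ∃ v : StripIndex, v.k = k ∧ IsVertex S n j v ∧ Follows f n j v := by
  have hm := (midpoint_mem hk).2.2
  have hδ1 := delta1_pos n j
  have hδ2 := delta2_pos n j
  obtain ⟨l1, h1, h2, h3⟩ := exists_nat_mul_le hδ1 (inv_delta1 hj) (hf.mapsTo hm)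
  obtain ⟨l2, h4, h5⟩ := exists_int_abs_le (derivWithin f (Icc 0 1) (midpoint j k) * (delta2 n j)⁻¹)
  refine ⟨⟨k, l1, l2⟩, rfl, ⟨?_, by simp, by simpa using h1, h4.trans ?_⟩,
    ⟨by simpa using h2, by simpa using h3, ?_⟩⟩
  · rw [inv_width]; exact_mod_cast hk
  · rw [abs_mul, abs_of_pos (inv_pos.2 hδ2)]
    exact mul_le_mul_of_nonneg_right (hf.slope _ hm) (inv_pos.2 hδ2).le
  · have h6 : (l2 : ℝ) * delta2 n j - derivWithin f (Icc 0 1) (midpoint j k)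
        = (l2 - derivWithin f (Icc 0 1) (midpoint j k) * (delta2 n j)⁻¹) * delta2 n j := by
      field
    dsimp only
    rw [h6, abs_mul, abs_of_pos hδ2]
    exact mul_le_of_le_one_left hδ2.le h5

variable (hα : α ∈ Ioc (1 : ℝ) 2) (hβ : 0 < β) (hw : 16 * β * width j ^ α ≤ thick n j)

include hα hβ hw

/-- The half thickness `t/2` covers Taylor error `t/8`, slope rounding `δ₂ w/2 = t/8` and value
rounding `δ₁ = t/4`. -/
theorem Follows.mem_strip {v : StripIndex} (hv : Follows f n j v) (hk : v.k < 2 ^ j) {x : ℝ}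
    (hx : x ∈ Ico ((v.k : ℝ) * width j) (((v.k : ℝ) + 1) * width j)) :
    (x, f x) ∈ strip n j v := by
  refine ⟨hx.1, hx.2, ?_⟩
  obtain ⟨h0, h1, hm⟩ := midpoint_mem hk
  have hw0 := width_pos j
  have hd : |x - midpoint j v.k| ≤ width j / 2 := by
    rw [abs_le, midpoint]
    constructor <;> linarith [hx.1, hx.2]
  have h2 := hf.abs_sub_sub_le hα hβ hm (y := x) ⟨h0.trans hx.1, hx.2.le.trans h1⟩
  have h3 : |x - midpoint j v.k| ^ α ≤ width j ^ α :=
    Real.rpow_le_rpow (abs_nonneg _) (by linarith) (by linarith [hα.1])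
  have h4 : 2 * β * |x - midpoint j v.k| ^ α ≤ thick n j / 8 := by
    have := mul_le_mul_of_nonneg_left h3 (by linarith : (0 : ℝ) ≤ 2 * β)
    linarith
  have h5 : |(v.l2 * delta2 n j - derivWithin f (Icc 0 1) (midpoint j v.k))
      * (x - midpoint j v.k)| ≤ thick n j / 8 := by
    rw [abs_mul]
    calc _ ≤ delta2 n j * (width j / 2) :=
          mul_le_mul hv.slope hd (abs_nonneg _) (delta2_pos n j).le
      _ = _ := by
          rw [← mul_div_assoc, delta2_mul_width, delta1]; ring
  have h6 := hv.le_value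
  have h7 := hv.value_le
  have h8 : delta1 n j = thick n j / 4 := rfl
  have h9 := abs_le.1 (h2.trans h4)
  have h10 := abs_le.1 h5
  change |f x - (v.l1 * delta1 n j + v.l2 * delta2 n j * (x - midpoint j v.k))| ≤ thick n j / 2
  rw [abs_le]
  rw [add_mul, one_mul] at h7
  rw [h8] at h6 h7 ⊢
  constructor <;> linarith [h9.1, h9.2, h10.1, h10.2]

/-- In units of `δ₁` the heights mismatch by at most 1 (rounding both values) + 1 (rounding the
slope) + 1/2 (Taylor); in units of `δ₂` the slopes differ by at most 1 + 1 + 1/2. Both stay below 4.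
-/
theorem Follows.goodContinuation {a b : StripIndex} (ha : Follows f n j a) (hb : Follows f n j b)
    (hab : b.k = a.k + 1) (hk : b.k < 2 ^ j) : GoodContinuation a b := by
  have hma := (midpoint_mem (show a.k < 2 ^ j by omega)).2.2
  have hmb := (midpoint_mem hk).2.2
  have hw0 := width_pos j
  have hδ1 := delta1_pos n j
  have hδ2 := delta2_pos n j
  have hd : midpoint j b.k - midpoint j a.k = width j := by
    simp only [midpoint, hab]; push_cast; ring
  have h1 := hf.abs_sub_sub_le hα hβ hma hmb
  have h2 := hf.holder _ hmb _ hma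
  rw [hd, abs_of_pos hw0] at h1 h2
  set g := derivWithin f (Icc 0 1)
  have h3 : 2 * β * width j ^ α ≤ delta1 n j / 2 := by rw [delta1]; linarith
  have h4 : α * β * width j ^ (α - 1) ≤ delta2 n j / 2 := by
    refine le_of_mul_le_mul_right ?_ hw0
    calc α * β * width j ^ (α - 1) * width j = α * β * width j ^ α := by
          rw [mul_assoc, ← Real.rpow_add_one hw0.ne', sub_add_cancel]
      _ ≤ 2 * β * width j ^ α := by
          have := Real.rpow_nonneg hw0.le α
          gcongr
          exact hα.2
      _ ≤ delta1 n j / 2 := h3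
      _ = _ := by rw [← delta2_mul_width]; ring
  have h5 := abs_le.1 (h1.trans h3)
  have h6 := abs_le.1 (h2.trans h4)
  have h7 := abs_le.1 ha.slope
  have h8 := abs_le.1 hb.slope
  have h9 := ha.le_value
  have h10 := ha.value_le
  have h11 := hb.le_value
  have h12 := hb.value_le
  have h13 : |(a.l2 : ℝ) * delta1 n j - g (midpoint j a.k) * width j| ≤ delta1 n j := by
    rw [← delta2_mul_width, ← mul_assoc, ← sub_mul, abs_mul, abs_of_pos hw0]
    exact mul_le_mul_of_nonneg_right ha.slope hw0.le
  have h14 := abs_le.1 h13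
  refine ⟨hab, ?_, ?_⟩
  · have : |(b.l1 : ℝ) - (a.l1 + a.l2)| ≤ 4 := by
      rw [abs_le]
      constructor
      · refine le_of_mul_le_mul_right ?_ hδ1
        linarith [h5.1, h14.1, h14.2]
      · refine le_of_mul_le_mul_right ?_ hδ1
        linarith [h5.2, h14.1, h14.2]
    exact_mod_cast this
  · have : |(b.l2 : ℝ) - a.l2| ≤ 4 := by
      rw [abs_le]
      constructor
      · refine le_of_mul_le_mul_right ?_ hδ2
        linarith [h6.1, h7.1, h7.2, h8.1, h8.2]
      · refine le_of_mul_le_mul_right ?_ hδ2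
        linarith [h6.2, h7.1, h7.2, h8.1, h8.2]
    exact_mod_cast this

end Follows

/-! ### Runs of significant strips along a graph -/

/-- A lower bound for the probability that some block among `B` blocks of `K` disjoint cells of probability at least
`q` contains more than `N` sample points in each of its cells. -/
theorem le_sampleLaw_exists_block (P : Measure (ℝ × ℝ)) [IsProbabilityMeasure P] {B K : ℕ}
    (hK : 0 < K) {A : Fin B × Fin K → Set (ℝ × ℝ)} (hA : ∀ i, MeasurableSet (A i))
    (hd : Pairwise (Function.onFun Disjoint A)) {q : ℝ} (hq0 : 0 ≤ q) (hq1 : K * q ≤ 1)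
    (hq : ∀ i, q ≤ P.real (A i)) (N n : ℕ) :
    ENNReal.ofReal (1 - (1 - (binTail q N n 0 ^ K - n * (K * q) ^ 2)) ^ B)
      ≤ sampleLaw n P {x | ∃ b, ∀ k, N < count x (A (b, k))} := by
  classical
  have hsum := sum_measureReal_le_one P hA hd
  let Φ : Set (Fin B × Fin K → ℕ) := {c | ∃ b, ∀ k, N < c (b, k)}
  let ψ : (Fin K → ℕ) → ℝ := fun c => ∏ k, if N < c k then 1 else 0
  have hψ1 : ∀ c, ψ c ≤ 1 := fun c => Finset.prod_le_one (fun k _ => by positivity)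
    fun k _ => by split_ifs <;> norm_num
  have hψ : Monotone ψ := fun c c' h => Finset.prod_le_prod (fun k _ => by positivity)
    fun k _ => monotone_ite_lt N k h
  have h1 := sampleLaw_count_mem P hA hd Φ n 0
  have h2 : {x : Fin n → ℝ × ℝ | (fun i => (0 : Fin B × Fin K → ℕ) i + count x (A i)) ∈ Φ}
      = {x | ∃ b, ∀ k, N < count x (A (b, k))} := by
    ext x; simp [Φ]
  have h3 : Φ.indicator (1 : (Fin B × Fin K → ℕ) → ℝ)
      = fun c => 1 - ∏ b : Fin B, (1 - ψ fun k => c (b, k)) := by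
    ext c
    have h4 : ∀ b, ψ (fun k => c (b, k)) = if ∀ k, N < c (b, k) then 1 else 0 := by
      intro b
      simp only [ψ]
      rw [Finset.prod_boole]
      simp
    by_cases hc : c ∈ Φ
    · rw [indicator_of_mem hc]
      obtain ⟨b, hb⟩ := hc
      rw [Finset.prod_eq_zero (Finset.mem_univ b)]
      · simp
      · rw [h4, if_pos hb, sub_self]
    · rw [indicator_of_notMem hc, Finset.prod_eq_one, sub_self]
      intro b _
      rw [h4, if_neg fun hb => hc ⟨b, hb⟩, sub_zero]
  rw [h2] at h1
  rw [h1, h3, occupancy_one_sub]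
  -- Failure of a block is a decreasing statistic of its cells, so negative association bounds the
  -- probability that all blocks fail.
  refine ENNReal.ofReal_le_ofReal (sub_le_sub_left ((occupancy_prod_le
    (fun i => measureReal_nonneg) hsum (φ := fun (_ : Fin B) c => 1 - ψ c)
    (fun b c => sub_nonneg.2 (hψ1 c))
    (.inr fun _ => fun c c' h => sub_le_sub_left (hψ h) 1) n 0).trans ?_) 1)
  rw [← Fin.prod_const]
  have hqb : ∀ b, ∑ k, P.real (A (b, k)) ≤ 1 := fun b =>
    (Finset.single_le_sum (f := fun b => ∑ k, P.real (A (b, k)))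
      (fun b _ => Finset.sum_nonneg fun k _ => measureReal_nonneg) (Finset.mem_univ b)).trans
      ((Fintype.sum_prod_type fun i => P.real (A i)).symm.trans_le hsum)
  refine Finset.prod_le_prod (fun b _ => ?_) fun b _ => ?_
  · rw [occupancy_one_sub]
    exact sub_nonneg.2 (occupancy_le_one (fun k => measureReal_nonneg) (hqb b) hψ1 _ _)
  · rw [occupancy_one_sub]
    -- Within a block, all cell probabilities are lowered to `q` before comparing with independent
    -- binomials.
    refine sub_le_sub_left (le_trans ?_ (occupancy_mono_prob (fun _ => hq0)
      (fun k => hq (b, k)) (hqb b) hψ n _)) 1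
    have h5 := prod_binTail_le (K := Fin K) hq0 (by simpa using hq1) (by simpa using hK) N n 0
    simp only [Pi.zero_apply, Finset.prod_const, Finset.card_univ, Fintype.card_fin] at h5
    exact h5

/-- One strip following the graph is chosen per column, and columns are numbered `b * K + k`. A
block whose strips are all significant is a significant path of `K > L` strips. -/
theorem HolderClass.le_sampleLaw_rejects {α β S : ℝ} {f : ℝ → ℝ} (hf : HolderClass α β S f)
    (hα : α ∈ Ioc (1 : ℝ) 2) (hβ : 0 < β) {ε : ℝ} (hε0 : 0 ≤ ε) (hε1 : ε ≤ 1) {n j : ℕ}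
    (hj : j ≤ dyadicLog n) (hw : 16 * β * width j ^ α ≤ thick n j) {B K : ℕ} (hK : 0 < K)
    (hBK : B * K ≤ 2 ^ j) {q : ℝ} (hq0 : 0 ≤ q) (hq1 : K * q ≤ 1)
    (hq : q ≤ ε * (width j / Real.sqrt (1 + S ^ 2))) (N : ℕ) {L : ℝ} (hL : L < K) :
    ENNReal.ofReal (1 - (1 - (binTail q N n 0 ^ K - n * (K * q) ^ 2)) ^ B)
      ≤ sampleLaw n (mixture ε f) (rejects S N L n) := by
  have := hf.isProbabilityMeasure_mixture hε0 hε1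
  have : Nonempty StripIndex := ⟨⟨0, 0, 0⟩⟩
  have hex : ∀ k, k < 2 ^ j → ∃ v : StripIndex, v.k = k ∧ IsVertex S n j v ∧ Follows f n j v :=
    fun k hk => hf.exists_follows hj hk
  choose! v hvk hvV hvF using hex
  have hlt : ∀ (b : Fin B) (k : Fin K), b * K + k < 2 ^ j := fun b k => by
    calc (b : ℕ) * K + k < b * K + K := by omega
      _ = (b + 1) * K := by ring
      _ ≤ B * K := Nat.mul_le_mul_right _ b.2
      _ ≤ _ := hBK
  have hinj : ∀ i i' : Fin B × Fin K, (i.1 : ℕ) * K + i.2 = i'.1 * K + i'.2 → i = i' := by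
    intro i i' h
    have h1 : (i.1 : ℕ) = i'.1 := by
      have := congrArg (· / K) h
      simpa [add_comm, Nat.add_mul_div_right _ _ hK, Nat.div_eq_of_lt] using this
    have h2 : (i.2 : ℕ) = i'.2 := by rw [h1] at h; omega
    exact Prod.ext (Fin.ext h1) (Fin.ext h2)
  refine (le_sampleLaw_exists_block (mixture ε f) hK
    (A := fun i => strip n j (v (i.1 * K + i.2))) (fun i => measurableSet_strip n j _)
    (fun i i' h => disjoint_strip ?_) hq0 hq1 (fun i => hq.trans ?_) N n).trans
    (measure_mono ?_)
  · rw [hvk _ (hlt i.1 i.2), hvk _ (hlt i'.1 i'.2)]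
    exact fun h' => h (hinj i i' h')
  · have hk := hlt i.1 i.2
    have h1 := midpoint_mem hk
    have h2 := hf.le_mixture hε0 hε1 (measurableSet_strip n j (v (i.1 * K + i.2))) h1.1 h1.2.1
      (fun x hx => (hvF _ hk).mem_strip hf hα hβ hw (by rwa [hvk _ hk]) (by rwa [hvk _ hk]))
    have h3 : (((i.1 * K + i.2 : ℕ) : ℝ) + 1) * width j - ((i.1 * K + i.2 : ℕ) : ℝ) * width j
        = width j := by ring
    rwa [h3] at h2
  · rintro x ⟨b, hb⟩
    refine hL.trans_le (Nat.cast_le.2 ?_)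
    have h1 : K - 1 < longestRun S N x := by
      refine lt_longestRun_iff.2 ⟨j, hj, List.ofFn fun k : Fin K => v (b * K + k), ⟨?_, ?_, ?_⟩, ?_⟩
      · intro w hw
        obtain ⟨k, rfl⟩ := List.mem_ofFn.1 hw
        exact hvV _ (hlt b k)
      · intro w hw
        obtain ⟨k, rfl⟩ := List.mem_ofFn.1 hw
        exact hb k
      · rw [List.isChain_ofFn]
        intro k hk
        have hk0 := hlt b ⟨k, by omega⟩
        have hk1 := hlt b ⟨k + 1, hk⟩
        refine (hvF _ hk0).goodContinuation hf hα hβ hw (hvF _ hk1) ?_ ?_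
        · rw [hvk _ hk0, hvk _ hk1]
          simp only []
          ring
        · rwa [hvk _ hk1]
      · rw [List.length_ofFn]; omega
    omega

/-! ### The choice of the scale and of the blocks -/

/-- The constant `c` such that the scale used against the class Hölder(α, β; S) has width of order
`c n^(-1/(1+α))`. -/
noncomputable def widthConst (α β : ℝ) : ℝ := min 1 ((16 * β) ^ (-(1 + α)⁻¹))

theorem widthConst_pos {α β : ℝ} (hβ : 0 < β) : 0 < widthConst α β :=
  lt_min one_pos (Real.rpow_pos_of_pos (by linarith) _)

/-- A dyadic scale of width comparable with `n^(-1/(1+α))`. -/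
theorem exists_scale {α β : ℝ} (hα : 1 < α) (hβ : 0 < β) {n : ℕ} (hn : 1 ≤ n)
    (hlarge : 2 * (n : ℝ) ^ (1 + α)⁻¹ / widthConst α β ≤ n) :
    ∃ j ≤ dyadicLog n, 16 * β * width j ^ α ≤ thick n j ∧ (n : ℝ) ^ (1 + α)⁻¹ ≤ 2 ^ j ∧
      widthConst α β / 2 * (n : ℝ) ^ (-(1 + α)⁻¹) ≤ width j := by
  have hn1 : (1 : ℝ) ≤ n := by exact_mod_cast hn
  have hn0 : (0 : ℝ) < n := by linarith
  have hα0 : 0 < 1 + α := by linarith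
  have hc0 : 0 < widthConst α β := widthConst_pos hβ
  have hc1 : widthConst α β ≤ 1 := min_le_left _ _
  set c := widthConst α β with hc
  set y := (n : ℝ) ^ (1 + α)⁻¹ with hy
  have hy1 : 1 ≤ y := Real.one_le_rpow hn1 (inv_nonneg.2 hα0.le)
  have hyc : y ≤ y / c := le_div_self (by linarith) hc0 hc1
  -- The scale is `j = i + 1`, so that `c/(2y) ≤ w ≤ c/y`; `c ≤ 1` ensures at least `y` columns.
  obtain ⟨i, hi1, hi2⟩ := exists_nat_pow_near (hy1.trans hyc) one_lt_two
  have h2 : (2 : ℝ) ^ (i + 1) ≤ 2 * (y / c) := by rw [pow_succ']; linarith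
  have hw := width_pos (i + 1)
  refine ⟨i + 1, ?_, ?_, hyc.trans hi2.le, ?_⟩
  · have h3 : (2 : ℝ) ^ (i + 1) ≤ 2 ^ dyadicLog n := by
      refine h2.trans ((le_of_eq (by ring)).trans (hlarge.trans ?_))
      exact_mod_cast le_two_pow_dyadicLog n
    exact (pow_le_pow_iff_right₀ one_lt_two).1 h3
  -- Multiplied by `w`, the Taylor condition reads `16 β w^(1+α) ≤ w t`; the left side is at most
  -- `1/n` by the choice of `c`, and `w t = 2 / 2 ^ J ≥ 1/n`.
  · refine le_of_mul_le_mul_right ?_ hw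
    have h4 : width (i + 1) ≤ c * y⁻¹ := by
      rw [width_eq, ← div_eq_mul_inv, ← inv_div]
      exact inv_anti₀ (by positivity) hi2.le
    have h5 : width (i + 1) ≤ (16 * β * n) ^ (-(1 + α)⁻¹) := by
      refine h4.trans ?_
      rw [Real.mul_rpow (by linarith) hn0.le, hy, ← Real.rpow_neg hn0.le]
      exact mul_le_mul_of_nonneg_right (min_le_right _ _) (Real.rpow_nonneg hn0.le _)
    have h6 : width (i + 1) ^ (1 + α) ≤ (16 * β * n)⁻¹ := by
      refine (Real.rpow_le_rpow hw.le h5 hα0.le).trans (le_of_eq ?_)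
      rw [← Real.rpow_mul (by positivity), neg_mul, inv_mul_cancel₀ hα0.ne', Real.rpow_neg_one]
    calc 16 * β * width (i + 1) ^ α * width (i + 1) = 16 * β * width (i + 1) ^ (1 + α) := by
          rw [mul_assoc, ← Real.rpow_add_one hw.ne', add_comm α]
      _ ≤ 16 * β * (16 * β * n)⁻¹ := by gcongr
      _ = 1 / n := by field
      _ ≤ 2 / 2 ^ dyadicLog n := by
          rw [div_le_div_iff₀ hn0 (by positivity), one_mul]
          exact_mod_cast two_pow_dyadicLog_le hn
      _ = thick n (i + 1) * width (i + 1) := by rw [mul_comm, width_mul_thick]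
  · rw [Real.rpow_neg hn0.le, width_eq, ← hy]
    calc c / 2 * y⁻¹ = (2 * (y / c))⁻¹ := by field
      _ ≤ _ := inv_anti₀ (by positivity) h2

theorem tendsto_natCast_rpow {a : ℝ} (ha : 0 < a) :
    Tendsto (fun n : ℕ => (n : ℝ) ^ a) atTop atTop :=
  (tendsto_rpow_atTop ha).comp tendsto_natCast_atTop_atTop

theorem eventually_runThreshold_le {p₀ : ℝ} (hp₀ : p₀ ∈ Ioo (0 : ℝ) 1) {a : ℝ} (ha : 0 < a) :
    ∀ᶠ n : ℕ in atTop, runThreshold p₀ n + 1 ≤ (n : ℝ) ^ a := by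
  have h1 : 0 < Real.log (1 / p₀) := Real.log_pos ((one_lt_div hp₀.1).2 hp₀.2)
  have h2 := ((isLittleO_log_rpow_atTop ha).comp_tendsto tendsto_natCast_atTop_atTop).bound
    (show 0 < Real.log (1 / p₀) / 6 by positivity)
  filter_upwards [h2, (tendsto_natCast_rpow ha).eventually_ge_atTop 2, eventually_ge_atTop 1]
    with n h3 h4 hn
  simp only [Function.comp, Real.norm_eq_abs] at h3
  rw [abs_of_nonneg (by positivity : (0 : ℝ) ≤ (n : ℝ) ^ a)] at h3
  have h5 := (le_abs_self _).trans h3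
  have h6 : runThreshold p₀ n ≤ (n : ℝ) ^ a / 2 := by
    rw [runThreshold, Real.logb, ← mul_div_assoc, div_le_iff₀ h1]
    linarith
  linarith

/-- The expected number of sample points per strip which suffices for detection. -/
theorem exists_mean {p₀ : ℝ} (hp₀ : p₀ ∈ Ioo (0 : ℝ) 1) (N : ℕ) :
    ∃ θ₀ : ℝ, 0 < θ₀ ∧ ∀ θ, θ₀ < θ → 2 ^ (N + 1) * Real.exp (-θ / 2) ≤ 1 - p₀ ^ (1 / 36 : ℝ) := by
  -- The exponent 1/36 makes a run of length `L_n^*` cost only `p₀ ^ (L_n^* / 36) = n^(-1/12)`.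
  have h1 : 0 < 1 - p₀ ^ (1 / 36 : ℝ) :=
    sub_pos.2 (Real.rpow_lt_one hp₀.1.le hp₀.2 (by norm_num))
  have h2 : Tendsto (fun θ : ℝ => 2 ^ (N + 1) * Real.exp (-θ / 2)) atTop (𝓝 0) := by
    have h3 : Tendsto (fun θ : ℝ => -θ / 2) atTop atBot :=
      tendsto_neg_atTop_atBot.atBot_div_const two_pos
    simpa using (Real.tendsto_exp_atBot.comp h3).const_mul ((2 : ℝ) ^ (N + 1))
  obtain ⟨θ₀, h4⟩ := eventually_atTop.1 (h2.eventually (Iic_mem_nhds h1))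
  exact ⟨max θ₀ 1, by positivity, fun θ h => h4 θ ((le_max_left _ _).trans h.le)⟩

theorem le_binTail {p₀ θ : ℝ} {N n : ℕ} (hn : 1 ≤ n) (hθ0 : 0 ≤ θ) (hθn : θ ≤ n)
    (hθ : 2 ^ (N + 1) * Real.exp (-θ / 2) ≤ 1 - p₀ ^ (1 / 36 : ℝ)) :
    p₀ ^ (1 / 36 : ℝ) ≤ binTail (θ / n) N n 0 := by
  have hn0 : (0 : ℝ) < n := by exact_mod_cast hn
  have h0 : θ / n ≤ 1 := div_le_one_of_le₀ hθn hn0.le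
  have h1 := one_sub_binTail_le (q := θ / n) (by positivity) h0 N n 0
  have h2 : (1 - θ / n / 2) ^ n ≤ Real.exp (-θ / 2) := by
    calc (1 - θ / n / 2) ^ n ≤ Real.exp (-(θ / n / 2)) ^ n :=
          pow_le_pow_left₀ (by linarith) (Real.one_sub_le_exp_neg _) n
      _ = _ := by rw [← Real.exp_nat_mul]; congr 1; field
  have h3 := mul_le_mul_of_nonneg_left h2 (show (0 : ℝ) ≤ 2 ^ (N + 1) by positivity)
  rw [pow_zero, mul_one] at h1
  linarith

/-- The probability that all the strips of a block are significant is not too small. -/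
theorem le_binTail_pow_sub {p₀ : ℝ} (hp₀ : p₀ ∈ Ioo (0 : ℝ) 1) {θ : ℝ} {N n K : ℕ} (hn : 1 ≤ n)
    (hθ0 : 0 ≤ θ) (hθn : θ ≤ n)
    (hθ : 2 ^ (N + 1) * Real.exp (-θ / 2) ≤ 1 - p₀ ^ (1 / 36 : ℝ))
    (hK : (K : ℝ) ≤ runThreshold p₀ n + 1) (hK' : (K : ℝ) ≤ (n : ℝ) ^ (1 / 12 : ℝ))
    (hlarge : 2 * θ ^ 2 / p₀ ^ (1 / 36 : ℝ) ≤ (n : ℝ) ^ (3 / 4 : ℝ)) :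
    p₀ ^ (1 / 36 : ℝ) / 2 * (n : ℝ) ^ (-1 / 12 : ℝ)
      ≤ binTail (θ / n) N n 0 ^ K - n * (K * (θ / n)) ^ 2 := by
  have hn0 : (0 : ℝ) < n := by exact_mod_cast hn
  set y := p₀ ^ (1 / 36 : ℝ) with hy
  have hy0 : 0 < y := Real.rpow_pos_of_pos hp₀.1 _
  have h1 : y * (n : ℝ) ^ (-1 / 12 : ℝ) ≤ binTail (θ / n) N n 0 ^ K := by
    refine le_trans ?_ (pow_le_pow_left₀ hy0.le (le_binTail hn hθ0 hθn hθ) K)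
    calc y * (n : ℝ) ^ (-1 / 12 : ℝ) = p₀ ^ ((1 / 36 : ℝ) * (runThreshold p₀ n + 1)) := by
          rw [mul_add, mul_one, Real.rpow_add hp₀.1, rpow_runThreshold hp₀ _ hn, mul_comm]
          rw [hy, show -3 * (1 / 36 : ℝ) = -1 / 12 by norm_num]
      _ ≤ p₀ ^ ((1 / 36 : ℝ) * K) :=
          Real.rpow_le_rpow_of_exponent_ge hp₀.1 hp₀.2.le (by linarith)
      _ = y ^ K := by rw [Real.rpow_mul hp₀.1.le, Real.rpow_natCast]
  -- Dependence costs at most half of the main term: 1/6 + 3/4 - 1 = -1/12.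
  have h2 : n * (K * (θ / n)) ^ 2 ≤ y / 2 * (n : ℝ) ^ (-1 / 12 : ℝ) := by
    have h3 : (K : ℝ) ^ 2 ≤ (n : ℝ) ^ (1 / 6 : ℝ) := by
      calc (K : ℝ) ^ 2 ≤ ((n : ℝ) ^ (1 / 12 : ℝ)) ^ 2 := by gcongr
        _ = _ := by rw [← Real.rpow_natCast, ← Real.rpow_mul hn0.le]; norm_num
    have h4 : θ ^ 2 ≤ y / 2 * (n : ℝ) ^ (3 / 4 : ℝ) := by
      rw [div_le_iff₀ hy0] at hlarge; linarith
    calc n * (K * (θ / n)) ^ 2 = (K : ℝ) ^ 2 * θ ^ 2 * (n : ℝ) ^ (-1 : ℝ) := by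
          rw [Real.rpow_neg_one]; field
      _ ≤ (n : ℝ) ^ (1 / 6 : ℝ) * (y / 2 * (n : ℝ) ^ (3 / 4 : ℝ)) * (n : ℝ) ^ (-1 : ℝ) := by gcongr
      _ = y / 2 * ((n : ℝ) ^ (1 / 6 : ℝ) * (n : ℝ) ^ (3 / 4 : ℝ) * (n : ℝ) ^ (-1 : ℝ)) := by ring
      _ = _ := by rw [← Real.rpow_add hn0, ← Real.rpow_add hn0]; norm_num
  linarith

/-- The power of the test: the probability of missing a curve carrying at least `θ` sample points
per strip, on average, is exponentially small in a power of `n`. -/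
theorem HolderClass.exp_le_sampleLaw_rejects {α β S : ℝ} {f : ℝ → ℝ} (hf : HolderClass α β S f)
    (hα : α ∈ Ioc (1 : ℝ) 2) (hβ : 0 < β) {p₀ : ℝ} (hp₀ : p₀ ∈ Ioo (0 : ℝ) 1) {N n : ℕ} {θ : ℝ}
    (hθ0 : 0 ≤ θ) (hθ : 2 ^ (N + 1) * Real.exp (-θ / 2) ≤ 1 - p₀ ^ (1 / 36 : ℝ)) (hn : 1 ≤ n)
    (hscale : 2 * (n : ℝ) ^ (1 + α)⁻¹ / widthConst α β ≤ n)
    (hrun : runThreshold p₀ n + 1 ≤ (n : ℝ) ^ (1 / 12 : ℝ))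
    (hlarge : 2 * θ ^ 2 / p₀ ^ (1 / 36 : ℝ) ≤ (n : ℝ) ^ (3 / 4 : ℝ))
    (hθn : θ ≤ (n : ℝ) ^ (11 / 12 : ℝ)) (hB : 2 ≤ (n : ℝ) ^ (1 / 4 : ℝ)) {ε : ℝ} (hε1 : ε ≤ 1)
    (hε : θ * (2 * Real.sqrt (1 + S ^ 2) / widthConst α β) * (n : ℝ) ^ (-α / (1 + α)) ≤ ε) :
    ENNReal.ofReal (1 - Real.exp (-(p₀ ^ (1 / 36 : ℝ) / 4 * (n : ℝ) ^ (1 / 6 : ℝ))))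
      ≤ sampleLaw n (mixture ε f) (rejects S N (runThreshold p₀ n) n) := by
  have hn0 : (0 : ℝ) < n := by exact_mod_cast hn
  have hn1 : (1 : ℝ) ≤ n := by exact_mod_cast hn
  have hα0 : 0 < 1 + α := by linarith [hα.1]
  have hc0 := widthConst_pos (α := α) hβ
  have hσ0 : 0 < Real.sqrt (1 + S ^ 2) := Real.sqrt_pos.2 (by positivity)
  set c := widthConst α β
  set σ := Real.sqrt (1 + S ^ 2) with hσ
  set y := p₀ ^ (1 / 36 : ℝ) with hy
  have hy0 : 0 < y := Real.rpow_pos_of_pos hp₀.1 _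
  obtain ⟨j, hj, hw, hcols, hwidth⟩ := exists_scale hα.1 hβ hn hscale
  have hε0 : 0 ≤ ε := le_trans (by positivity) hε
  set L := runThreshold p₀ n with hL
  have hL0 : 0 ≤ L := runThreshold_nonneg hp₀ hn
  set K := ⌊L⌋₊ + 1 with hK
  have hKL : (K : ℝ) ≤ L + 1 := by
    rw [hK]; push_cast; linarith [Nat.floor_le hL0]
  have hKn : (K : ℝ) ≤ (n : ℝ) ^ (1 / 12 : ℝ) := hKL.trans hrun
  -- The blocks fit since 1/4 + 1/12 = 1/3 ≤ 1/(1+α), by `α ≤ 2`; they suffice since 1/4 - 1/12 > 0.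
  set B := ⌊(n : ℝ) ^ (1 / 4 : ℝ)⌋₊ with hBdef
  have hBle : (B : ℝ) ≤ (n : ℝ) ^ (1 / 4 : ℝ) := Nat.floor_le (by positivity)
  have hBge : (n : ℝ) ^ (1 / 4 : ℝ) / 2 ≤ B := by
    linarith [Nat.lt_floor_add_one ((n : ℝ) ^ (1 / 4 : ℝ))]
  have hBK : B * K ≤ 2 ^ j := by
    have : (B : ℝ) * K ≤ 2 ^ j := by
      calc (B : ℝ) * K ≤ (n : ℝ) ^ (1 / 4 : ℝ) * (n : ℝ) ^ (1 / 12 : ℝ) := by gcongr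
        _ = (n : ℝ) ^ (1 / 3 : ℝ) := by rw [← Real.rpow_add hn0]; norm_num
        _ ≤ (n : ℝ) ^ (1 + α)⁻¹ := by
            refine Real.rpow_le_rpow_of_exponent_le hn1 ?_
            rw [one_div]
            exact inv_anti₀ hα0 (by linarith [hα.2])
        _ ≤ _ := hcols
    exact_mod_cast this
  have hKq : K * (θ / n) ≤ 1 := by
    rw [← mul_div_assoc, div_le_one hn0]
    calc K * θ ≤ (n : ℝ) ^ (1 / 12 : ℝ) * (n : ℝ) ^ (11 / 12 : ℝ) := by gcongr
      _ = n := by rw [← Real.rpow_add hn0]; norm_num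
  -- The detection rate: n^(-α/(1+α)) from `ε` times n^(-1/(1+α)) from the width is 1/n.
  have hq : θ / n ≤ ε * (width j / σ) := by
    calc θ / n = θ * (2 * σ / c) * (n : ℝ) ^ (-α / (1 + α))
          * (c / 2 * (n : ℝ) ^ (-(1 + α)⁻¹) / σ) := by
          have h1 : (n : ℝ) ^ (-α / (1 + α)) * (n : ℝ) ^ (-(1 + α)⁻¹) = (n : ℝ)⁻¹ := by
            rw [← Real.rpow_add hn0, ← Real.rpow_neg_one (n : ℝ)]
            congr 1
            field
          rw [div_eq_mul_inv, ← h1]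
          generalize (n : ℝ) ^ (-α / (1 + α)) = u
          generalize (n : ℝ) ^ (-(1 + α)⁻¹) = v
          field
      _ ≤ _ := by gcongr
  have hθn' : θ ≤ n := by
    refine hθn.trans ?_
    conv_rhs => rw [← Real.rpow_one (n : ℝ)]
    exact Real.rpow_le_rpow_of_exponent_le hn1 (by norm_num)
  have h1 := hf.le_sampleLaw_rejects hα hβ hε0 hε1 hj hw (Nat.succ_pos _) hBK
    (show 0 ≤ θ / n by positivity) hKq hq N (L := L)
    (by push_cast; exact Nat.lt_floor_add_one L)
  refine le_trans (ENNReal.ofReal_le_ofReal (sub_le_sub_left ?_ 1)) h1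
  have h2 := le_binTail_pow_sub hp₀ hn hθ0 hθn' hθ hKL hKn hlarge
  set r := binTail (θ / n) N n 0 ^ K - n * (K * (θ / n)) ^ 2
  have hr1 : r ≤ 1 := by
    have hq1 : θ / n ≤ 1 := div_le_one_of_le₀ hθn' hn0.le
    have h3 := pow_le_one₀ (n := K) (binTail_nonneg (by positivity) hq1 N n 0)
      (binTail_le_one (by positivity) hq1 N n 0)
    have h4 : 0 ≤ n * (K * (θ / n)) ^ 2 := by positivity
    linarith
  calc (1 - r) ^ B ≤ Real.exp (-(y / 2 * (n : ℝ) ^ (-1 / 12 : ℝ))) ^ B :=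
        pow_le_pow_left₀ (by linarith) ((sub_le_sub_left h2 1).trans (Real.one_sub_le_exp_neg _)) B
    _ = Real.exp (-(y / 2 * (n : ℝ) ^ (-1 / 12 : ℝ) * B)) := by
        rw [← Real.exp_nat_mul]; congr 1; ring
    _ ≤ _ := by
        refine Real.exp_le_exp.2 (neg_le_neg ?_)
        calc y / 4 * (n : ℝ) ^ (1 / 6 : ℝ)
            = y / 2 * (n : ℝ) ^ (-1 / 12 : ℝ) * ((n : ℝ) ^ (1 / 4 : ℝ) / 2) := by
              have : (n : ℝ) ^ (1 / 6 : ℝ) = (n : ℝ) ^ (-1 / 12 : ℝ) * (n : ℝ) ^ (1 / 4 : ℝ) := by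
                rw [← Real.rpow_add hn0]; norm_num
              rw [this]; ring
          _ ≤ _ := by gcongr

end SigRuns

/-! ### Conclusion: the detection constant and uniformity. -/

theorem theorem3p1 (S : ℝ) (hS : 1 < S) (p₀ : ℝ) (hp₀ : p₀ ∈ Ioo (0 : ℝ) 1) :
    (∃ N : ℕ, SigRuns.IsCountThreshold p₀ N) ∧
    ∀ N : ℕ, SigRuns.IsCountThreshold p₀ N →
      (∀ α ∈ Ioc (1 : ℝ) 2, ∀ β : ℝ, 0 < β →
        ∃ T : ℝ, 0 < T ∧ ∀ τ : ℝ, T < τ →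
          ∀ η : ℝ, 0 < η → ∀ᶠ n : ℕ in atTop,
            ∀ f : ℝ → ℝ, SigRuns.HolderClass α β S f →
            ∀ ε : ℝ, τ * (n : ℝ) ^ (-α / (1 + α)) < ε → ε ≤ 1 →
              ENNReal.ofReal (1 - η) ≤
                SigRuns.sampleLaw n (SigRuns.mixture ε f)
                  (SigRuns.rejects S N (SigRuns.runThreshold p₀ n) n)) ∧
      Tendsto (fun n : ℕ =>
          SigRuns.sampleLaw n SigRuns.unifSquare
            (SigRuns.rejects S N (SigRuns.runThreshold p₀ n) n))
        atTop (𝓝 0) := by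
  refine ⟨SigRuns.exists_isCountThreshold hp₀.1, fun N hN =>
    ⟨fun α hα β hβ => ?_, SigRuns.tendsto_sampleLaw_unifSquare_rejects hS.le hp₀ hN⟩⟩
  obtain ⟨θ₀, hθ₀, hθ⟩ := SigRuns.exists_mean hp₀ N
  have hc0 := SigRuns.widthConst_pos (α := α) hβ
  have hσ0 : 0 < Real.sqrt (1 + S ^ 2) := Real.sqrt_pos.2 (by positivity)
  have hy0 : 0 < p₀ ^ (1 / 36 : ℝ) := Real.rpow_pos_of_pos hp₀.1 _
  set c := SigRuns.widthConst α β with hc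
  set A := 2 * Real.sqrt (1 + S ^ 2) / c with hA
  have hA0 : 0 < A := by positivity
  -- `A` converts `τ` into the guaranteed mean `θ = τ / A` per strip. As `θ` is free of `f` and `ε`,
  -- so are all the largeness conditions on `n` below.
  refine ⟨θ₀ * A, by positivity, fun τ hτ η hη => ?_⟩
  have hτA : θ₀ < τ / A := (lt_div_iff₀ hA0).2 hτ
  have hγ : (1 + α)⁻¹ < 1 := inv_lt_one_of_one_lt₀ (by linarith [hα.1])
  have hscale : ∀ᶠ n : ℕ in atTop, 2 * (n : ℝ) ^ (1 + α)⁻¹ / c ≤ n := by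
    filter_upwards [(SigRuns.tendsto_natCast_rpow (sub_pos.2 hγ)).eventually_ge_atTop (2 / c),
      eventually_ge_atTop 1] with n h1 hn
    have hn0 : (0 : ℝ) < n := by exact_mod_cast hn
    calc 2 * (n : ℝ) ^ (1 + α)⁻¹ / c = 2 / c * (n : ℝ) ^ (1 + α)⁻¹ := by ring
      _ ≤ (n : ℝ) ^ (1 - (1 + α)⁻¹) * (n : ℝ) ^ (1 + α)⁻¹ := by gcongr
      _ = n := by rw [← Real.rpow_add hn0, sub_add_cancel, Real.rpow_one]
  have hexp : Tendsto (fun n : ℕ =>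
      Real.exp (-(p₀ ^ (1 / 36 : ℝ) / 4 * (n : ℝ) ^ (1 / 6 : ℝ)))) atTop (𝓝 0) :=
    Real.tendsto_exp_neg_atTop_nhds_zero.comp
      ((SigRuns.tendsto_natCast_rpow (by norm_num)).const_mul_atTop (by positivity))
  filter_upwards [hscale, SigRuns.eventually_runThreshold_le hp₀ (show (0 : ℝ) < 1 / 12 by norm_num),
    (SigRuns.tendsto_natCast_rpow (show (0 : ℝ) < 3 / 4 by norm_num)).eventually_ge_atTop
      (2 * (τ / A) ^ 2 / p₀ ^ (1 / 36 : ℝ)),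
    (SigRuns.tendsto_natCast_rpow (show (0 : ℝ) < 11 / 12 by norm_num)).eventually_ge_atTop (τ / A),
    (SigRuns.tendsto_natCast_rpow (show (0 : ℝ) < 1 / 4 by norm_num)).eventually_ge_atTop 2,
    hexp.eventually (Iic_mem_nhds hη), eventually_ge_atTop 1]
    with n h1 h2 h3 h4 h5 h6 hn f hf ε hε hε1
  refine (ENNReal.ofReal_le_ofReal (sub_le_sub_left h6 1)).trans
    (hf.exp_le_sampleLaw_rejects hα hβ hp₀ (hθ₀.trans hτA).le (hθ _ hτA) hn h1 h2 h3 h4 h5 hε1 ?_)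
  rw [← hc, ← hA, div_mul_cancel₀ _ hA0.ne']
  exact hε.le
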